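/- Let $A$ be a finitely generated associative unital $\mathbb{C}$-algebra and let $M$ be a finite dimensional semisimple (left) $A$-module. Let $\mathfrak m$ be the kernel of $A\to \mathrm{End}_{\mathbb C}(M)$, let $\hat A_{\mathfrak m}=\varprojlim_k A/\mathfrak m^k$, and let $S_v$ ($v\in V$) be the simple factors of $M$, one for each isomorphism class, so that $A/\mathfrak m\cong\prod_v \mathrm{End}_{\mathbb C}(S_v)$. For a quiver $Q$ with finite vertex set, $\mathbb{C}\hat Q=\prod_n W^{\otimes n}$ is its completed path algebra, where $W$ is the span of the arrows, tensor products are over the span of the vertices, and $h(a)\,a\,t(a)=a$ for every arrow $a$ with head $h(a)$ and tail $t(a)$. A series has degree at least $n$ if its components of degree $<n$ vanish; closed ideals are taken with respect to this filtration, and $(r_i,\ i\in\mathcal I)$ denotes the smallest closed two-sided ideal containing the $r_i$. A completed path algebra with relations is a quotient $\mathbb{C}\hat Q/I$ by a closed two-sided ideal $I$ all of whose elements have degree at least $2$. The local model $L_MA$ is the completed path algebra with relations Morita equivalent to $\hat A_{\mathfrak m}$, namely the algebra $\mathbb{C}\hat Q/I\cong e\hat A_{\mathfrak m}e$, where $Q$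 has vertex set $V$, $e=\sum_v \varepsilon_v$, the $\varepsilon_v$ are orthogonal idempotents of $\hat A_{\mathfrak m}$, the image of $\varepsilon_v$ in $A/\mathfrak m$ is a minimal idempotent of the factor $\mathrm{End}_{\mathbb C}(S_v)$, and the vertex $v$ corresponds to $\varepsilon_v$. The local quiver $Q_M$ is the quiver $Q$ underlying $L_MA$; its vertices are labelled by the isomorphism classes of simple factors of $M$. **Theorem.** Let $N$ be a finite dimensional semisimple $A$-module with $L_NA=\mathbb{C}\hat Q_N/(r_i,\ i\in\mathcal I)$, and let $M$ be a submodule of $N$. Then $Q_M$ is (up to an isomorphism of quivers compatible with the labelling of the vertices by simple modules) the quiver obtained from $Q_N$ by deleting the vertices of the factors that do not occur in $M$ and all arrows attached to them. Moreover, if $\pi:\mathbb{C}\hat Q_N\to\mathbb{C}\hat Q_M$ is the standard projection, which identifies the common vertices and arrows and deletes from a series all paths through a deleted vertex (so that it maps all other vertices and arrows to zero), then $$L_MA=\mathbb{C}\hat Q_M/(\pi(r_i),\ i\in\mathcal I).$$ -/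

import Mathlib

noncomputable section

/-! ### The completed path algebra of a quiver

A path `p : Quiver.Path a b` has tail (source) `a` and head (target) `b`. -/

/-- All ways of cutting a path `p` from `a` to `b` into an initial part `q : Quiver.Path a c` and a final
part `r : Quiver.Path c b`. -/
def pathSplits {V : Type*} [Quiver V] {a : V} :
    ∀ {b : V}, Quiver.Path a b → List (Σ c : V, Quiver.Path a c × Quiver.Path c b)
  | _, Quiver.Path.nil => [⟨a, Quiver.Path.nil, Quiver.Path.nil⟩]
  | b, Quiver.Path.cons p e =>
      ⟨b, Quiver.Path.cons p e, Quiver.Path.nil⟩ ::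
        (pathSplits p).map fun s => ⟨s.1, s.2.1, Quiver.Path.cons s.2.2 e⟩

/-- Arbitrary formal (possibly infinite) `ℂ`-linear combinations of the paths of a quiver. -/
def PathSeries (V : Type*) [Quiver V] : Type _ := ∀ a b : V, Quiver.Path a b → ℂ

namespace PathSeries

variable {V : Type*} [Quiver V]

instance : AddCommGroup (PathSeries V) := inferInstanceAs (AddCommGroup (∀ a b : V, Quiver.Path a b → ℂ))

instance : Module ℂ (PathSeries V) := inferInstanceAs (Module ℂ (∀ a b : V, Quiver.Path a b → ℂ))

@[ext] theorem ext {f g : PathSeries V} (h : ∀ a b (p : Quiver.Path a b), f a b p = g a b p) : f = g :=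
  funext fun a => funext fun b => funext fun p => h a b p

@[simp] theorem add_apply (f g : PathSeries V) (a b : V) (p : Quiver.Path a b) :
    (f + g) a b p = f a b p + g a b p := rfl

@[simp] theorem zero_apply (a b : V) (p : Quiver.Path a b) : (0 : PathSeries V) a b p = 0 := rfl

@[simp] theorem sub_apply (f g : PathSeries V) (a b : V) (p : Quiver.Path a b) :
    (f - g) a b p = f a b p - g a b p := rfl

@[simp] theorem smul_apply (c : ℂ) (f : PathSeries V) (a b : V) (p : Quiver.Path a b) :
    (c • f) a b p = c * f a b p := rfl

/-- The convolution product. Paths are composed like functions: the product `x y` of two paths is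
"first `y`, then `x`" when the tail of `x` is the head of `y`, and zero otherwise. In particular
`h(x) x t(x) = x` for a path `x` with head `h(x)` and tail `t(x)`. -/
instance : Mul (PathSeries V) :=
  ⟨fun f g a b p => ((pathSplits p).map fun s => f s.1 b s.2.2 * g a s.1 s.2.1).sum⟩

theorem mul_apply (f g : PathSeries V) (a b : V) (p : Quiver.Path a b) :
    (f * g) a b p = ((pathSplits p).map fun s => f s.1 b s.2.2 * g a s.1 s.2.1).sum := rfl

/-- The identity: the sum of all paths of length zero. -/
instance : One (PathSeries V) := ⟨fun _ _ p => if p.length = 0 then 1 else 0⟩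

theorem one_apply (a b : V) (p : Quiver.Path a b) :
    (1 : PathSeries V) a b p = if p.length = 0 then 1 else 0 := rfl

/-- Auxiliary to associativity: `∑ f(r) g(q)` over the cuts of `p` into `q` followed by `r`. -/
def conv {a b : V} (f : ∀ x, Quiver.Path x b → ℂ) (g : ∀ x, Quiver.Path a x → ℂ) (p : Quiver.Path a b) : ℂ :=
  ((pathSplits p).map fun s => f s.1 s.2.2 * g s.1 s.2.1).sum

theorem conv_nil {a : V} (f : ∀ x, Quiver.Path x a → ℂ) (g : ∀ x, Quiver.Path a x → ℂ) :
    conv f g (Quiver.Path.nil : Quiver.Path a a) = f a Quiver.Path.nil * g a Quiver.Path.nil := by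
  simp [conv, pathSplits]

theorem conv_cons {a b c : V} (f : ∀ x, Quiver.Path x c → ℂ) (g : ∀ x, Quiver.Path a x → ℂ) (p : Quiver.Path a b)
    (e : b ⟶ c) :
    conv f g (p.cons e) =
      f c Quiver.Path.nil * g c (p.cons e) + conv (fun x r => f x (r.cons e)) g p := by
  simp [conv, pathSplits, Function.comp_def]

theorem conv_add_left {a b : V} (f f' : ∀ x, Quiver.Path x b → ℂ) (g : ∀ x, Quiver.Path a x → ℂ)
    (p : Quiver.Path a b) :
    conv (fun x r => f x r + f' x r) g p = conv f g p + conv f' g p := by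
  simp [conv, add_mul]

theorem conv_smul_left {a b : V} (k : ℂ) (f : ∀ x, Quiver.Path x b → ℂ) (g : ∀ x, Quiver.Path a x → ℂ)
    (p : Quiver.Path a b) :
    conv (fun x r => k * f x r) g p = k * conv f g p := by
  simp [conv, mul_assoc, List.sum_map_mul_left]

theorem conv_assoc {a b : V} (f : ∀ x, Quiver.Path x b → ℂ) (g : ∀ x y, Quiver.Path x y → ℂ)
    (h : ∀ x, Quiver.Path a x → ℂ) (p : Quiver.Path a b) :
    conv (fun x r => conv f (g x) r) h p =
      conv f (fun x r => conv (fun y q => g y x q) h r) p := by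
  induction p with
  | nil => simp [conv_nil, mul_assoc]
  | cons p e ih =>
    rw [conv_cons, conv_cons, conv_cons, conv_nil]
    simp only [conv_cons]
    rw [conv_add_left, conv_smul_left, ih]
    ring

theorem conv_one_right {a b : V} (f : ∀ x, Quiver.Path x b → ℂ) (p : Quiver.Path a b) :
    conv f (fun x r => (1 : PathSeries V) a x r) p = f a p := by
  induction p with
  | nil => simp [conv_nil, one_apply]
  | cons p e ih => rw [conv_cons, ih]; simp [one_apply]

theorem conv_zero_left {a b : V} (g : ∀ x, Quiver.Path a x → ℂ) (p : Quiver.Path a b) :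
    conv (fun _ _ => 0) g p = 0 := by
  simp [conv]

theorem conv_one_left {a b : V} (g : ∀ x, Quiver.Path a x → ℂ) (p : Quiver.Path a b) :
    conv (fun x r => (1 : PathSeries V) x b r) g p = g b p := by
  cases p with
  | nil => simp [conv_nil, one_apply]
  | cons p e => rw [conv_cons]; simp [one_apply, conv_zero_left]

theorem mul_eq_conv (f g : PathSeries V) (a b : V) (p : Quiver.Path a b) :
    (f * g) a b p = conv (fun x r => f x b r) (fun x r => g a x r) p := rfl

instance : Ring (PathSeries V) where
  __ := (inferInstance : AddCommGroup (PathSeries V))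
  __ := (inferInstance : Mul (PathSeries V))
  __ := (inferInstance : One (PathSeries V))
  left_distrib f g h := by
    ext a b p; simp [mul_apply, mul_add]
  right_distrib f g h := by
    ext a b p; simp [mul_apply, add_mul]
  zero_mul f := by ext a b p; simp [mul_apply]
  mul_zero f := by ext a b p; simp [mul_apply]
  mul_assoc f g h := by
    ext a b p
    simp only [mul_eq_conv]
    exact conv_assoc (fun x r => f x b r) (fun x y r => g x y r) (fun x r => h a x r) p
  one_mul f := by ext a b p; rw [mul_eq_conv, conv_one_left]
  mul_one f := by ext a b p; rw [mul_eq_conv, conv_one_right]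

instance : Algebra ℂ (PathSeries V) :=
  Algebra.ofModule
    (fun k f g => by
      ext a b p
      simp [mul_apply, mul_assoc, List.sum_map_mul_left])
    (fun k f g => by
      ext a b p
      simp [mul_apply, mul_left_comm, List.sum_map_mul_left])

end PathSeries

theorem comp_of_mem_pathSplits {V : Type*} [Quiver V] {a b : V} (p : Quiver.Path a b) :
    ∀ s ∈ pathSplits p, s.2.1.comp s.2.2 = p := by
  induction p with
  | nil => intro s hs; simp [pathSplits] at hs; subst hs; rfl
  | cons p e ih =>
    intro s hs
    simp only [pathSplits, List.mem_cons, List.mem_map] at hs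
    rcases hs with rfl | ⟨t, ht, rfl⟩
    · rfl
    · simp [Quiver.Path.comp_cons, ih t ht]

/-- The completed path algebra `ℂQ̂ = ∏ₙ W^{⊗n}` of a quiver `Q` with finitely many vertices: `W` is
spanned by the arrows, so `W^{⊗n}` consists of the finite linear combinations of the paths of
length `n`. (The finiteness condition is void when there are finitely many arrows.) -/
def CompletedPathAlgebra (V : Type*) [Finite V] [Quiver V] : Subalgebra ℂ (PathSeries V) where
  carrier := {f | ∀ n : ℕ,
    {p : Σ a b : V, Quiver.Path a b | p.2.2.length = n ∧ f p.1 p.2.1 p.2.2 ≠ 0}.Finite}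
  add_mem' {f g} hf hg n := by
    refine ((hf n).union (hg n)).subset ?_
    rintro p ⟨hn, hp⟩
    by_cases h : f p.1 p.2.1 p.2.2 = 0
    · right
      refine ⟨hn, fun h' => hp ?_⟩
      simp [h, h']
    · exact Or.inl ⟨hn, h⟩
  mul_mem' {f g} hf hg n := by
    classical
    have hF : (⋃ k ∈ Set.Iic n,
        {p : Σ a b : V, Quiver.Path a b | p.2.2.length = k ∧ f p.1 p.2.1 p.2.2 ≠ 0}).Finite :=
      (Set.finite_Iic n).biUnion fun k _ => hf k
    have hG : (⋃ k ∈ Set.Iic n,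
        {p : Σ a b : V, Quiver.Path a b | p.2.2.length = k ∧ g p.1 p.2.1 p.2.2 ≠ 0}).Finite :=
      (Set.finite_Iic n).biUnion fun k _ => hg k
    let c : (Σ a b : V, Quiver.Path a b) × (Σ a b : V, Quiver.Path a b) → Σ a b : V, Quiver.Path a b := fun z =>
      if h : z.2.2.1 = z.1.1 then
        ⟨z.2.1, z.1.2.1, z.2.2.2.comp (h.symm ▸ z.1.2.2)⟩ else z.1
    refine ((hF.prod hG).image c).subset ?_
    rintro ⟨a, b, p⟩ ⟨hn, hp⟩
    obtain ⟨s, hs, hne⟩ : ∃ s ∈ pathSplits p, f s.1 b s.2.2 * g a s.1 s.2.1 ≠ 0 := by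
      by_contra! hcon
      refine hp ?_
      change ((pathSplits p).map fun s => f s.1 b s.2.2 * g a s.1 s.2.1).sum = 0
      refine List.sum_eq_zero ?_
      intro x hx
      obtain ⟨s, hs, rfl⟩ := List.mem_map.1 hx
      exact hcon s hs
    have hc := comp_of_mem_pathSplits p s hs
    have hl : s.2.1.length + s.2.2.length = n := by
      rw [← Quiver.Path.length_comp, hc]; exact hn
    refine ⟨(⟨s.1, b, s.2.2⟩, ⟨a, s.1, s.2.1⟩), ⟨?_, ?_⟩, ?_⟩
    · simp only [Set.mem_iUnion]
      exact ⟨s.2.2.length, by simp only [Set.mem_Iic]; omega, rfl, left_ne_zero_of_mul hne⟩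
    · simp only [Set.mem_iUnion]
      exact ⟨s.2.1.length, by simp only [Set.mem_Iic]; omega, rfl, right_ne_zero_of_mul hne⟩
    · simp [c, hc]
  algebraMap_mem' k n := by
    refine (Set.finite_range fun v : V => (⟨v, v, Quiver.Path.nil⟩ : Σ a b : V, Quiver.Path a b)).subset ?_
    rintro ⟨a, b, p⟩ ⟨-, hp⟩
    cases p with
    | nil => exact ⟨a, rfl⟩
    | cons p e =>
      refine absurd ?_ hp
      simp [Algebra.algebraMap_eq_smul_one, PathSeries.one_apply]

open Classical in
/-- The idempotent of `ℂQ̂` given by the vertex `v` (the path of length zero at `v`). -/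
def vertexIdempotent {V : Type*} [Finite V] [Quiver V] (v : V) : CompletedPathAlgebra V :=
  ⟨fun a _ p => if a = v ∧ p.length = 0 then 1 else 0, fun n => by
    refine (Set.finite_singleton (⟨v, v, Quiver.Path.nil⟩ : Σ a b : V, Quiver.Path a b)).subset ?_
    rintro ⟨a, b, p⟩ ⟨-, hp⟩
    have h : a = v ∧ p.length = 0 := by
      by_contra h
      exact hp (if_neg h)
    obtain ⟨rfl, h⟩ := h
    obtain rfl := Quiver.Path.eq_of_length_zero p h
    obtain rfl := Quiver.Path.eq_nil_of_length_zero p h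
    rfl⟩

/-- `f` has degree at least `n`, i.e. its homogeneous components of degree `< n` vanish. For a
finite quiver this says that `f` lies in the `n`-th power of the ideal generated by the arrows. -/
def DegreeGE {V : Type*} [Finite V] [Quiver V] (n : ℕ) (f : CompletedPathAlgebra V) : Prop :=
  ∀ (a b : V) (p : Quiver.Path a b), p.length < n → f.1 a b p = 0

/-- `I` is closed in the topology defined by the degree filtration (the arrow-adic topology). -/
def IsClosedIdeal {V : Type*} [Finite V] [Quiver V] (I : Ideal (CompletedPathAlgebra V)) : Prop :=
  ∀ f, (∀ n : ℕ, ∃ g ∈ I, DegreeGE n (f - g)) → f ∈ I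

/-- The smallest closed two-sided ideal containing the set `R`. -/
def closedIdealSpan {V : Type*} [Finite V] [Quiver V] (R : Set (CompletedPathAlgebra V)) :
    Ideal (CompletedPathAlgebra V) :=
  sInf {I | I.IsTwoSided ∧ IsClosedIdeal I ∧ R ⊆ I}

instance {V : Type*} [Finite V] [Quiver V] (R : Set (CompletedPathAlgebra V)) :
    (closedIdealSpan R).IsTwoSided :=
  ⟨fun b ha => by
    rw [closedIdealSpan, Submodule.mem_sInf] at ha ⊢
    intro I hI
    have := hI.1
    exact Ideal.mul_mem_right _ _ (ha I hI)⟩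

/-! ### Deleting vertices of a quiver -/

/-- The quiver obtained by keeping only the vertices that satisfy `P`, and all arrows between them,
i.e. by deleting the other vertices and every arrow attached to a deleted vertex. -/
structure KeepVertices {V : Type*} (P : V → Prop) where
  /-- The vertex of the original quiver. -/
  val : V
  property : P val

namespace KeepVertices

variable {V : Type*} (P : V → Prop)

instance [Finite V] : Finite (KeepVertices P) :=
  Finite.of_injective (fun v => v.val) fun v w h => by cases v; cases w; cases h; rfl

instance [Quiver V] : Quiver (KeepVertices P) := ⟨fun v w => v.val ⟶ w.val⟩

/-- The inclusion of the remaining quiver. -/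
def incl [Quiver V] : KeepVertices P ⥤q V where
  obj v := v.val
  map e := e

variable [Quiver V]

theorem length_mapPath {a b : KeepVertices P} (p : Quiver.Path a b) :
    ((incl P).mapPath p).length = p.length := by
  induction p with
  | nil => rfl
  | cons p e ih => simpa using ih

theorem pathSplits_mapPath {a b : KeepVertices P} (p : Quiver.Path a b) :
    pathSplits ((incl P).mapPath p) =
      (pathSplits p).map fun s => 
        ⟨(incl P).obj s.1, (incl P).mapPath s.2.1, (incl P).mapPath s.2.2⟩ := by
  induction p with
  | nil => rfl
  | cons p e ih =>
    rw [Prefunctor.mapPath_cons, pathSplits, pathSplits, ih]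
    simp only [List.map_cons, List.map_map]
    rfl

theorem mapPath_injective :
    Function.Injective fun p : Σ a b : KeepVertices P, Quiver.Path a b =>
      (⟨(incl P).obj p.1, (incl P).obj p.2.1, (incl P).mapPath p.2.2⟩ : Σ a b : V, Quiver.Path a b) := by
  rintro ⟨a, b, p⟩ ⟨a', b', p'⟩ h
  induction p generalizing b' with
  | nil =>
    cases p' with
    | nil =>
      obtain ⟨a, ha⟩ := a
      obtain ⟨a', ha'⟩ := a'
      obtain rfl : a = a' := congrArg Sigma.fst h
      rfl
    | cons q e =>
      have := congrArg (fun z : Σ a b : V, Quiver.Path a b => z.2.2.length) h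
      exact absurd this (Nat.succ_ne_zero _).symm
  | @cons c b q e ih =>
    cases p' with
    | nil =>
      have := congrArg (fun z : Σ a b : V, Quiver.Path a b => z.2.2.length) h
      exact absurd this (Nat.succ_ne_zero _)
    | @cons c' _ q' e' =>
      obtain ⟨a, ha⟩ := a
      obtain ⟨a', ha'⟩ := a'
      obtain ⟨b, hb⟩ := b
      obtain ⟨b', hb'⟩ := b'
      obtain ⟨c, hc⟩ := c
      obtain ⟨c', hc'⟩ := c'
      obtain rfl : a = a' := congrArg Sigma.fst h
      have h1 := eq_of_heq (Sigma.mk.inj h).2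
      obtain rfl : b = b' := congrArg Sigma.fst h1
      have h2 := eq_of_heq (Sigma.mk.inj h1).2
      change ((incl P).mapPath q).cons e = ((incl P).mapPath q').cons e' at h2
      obtain rfl : c = c' := Quiver.Path.obj_eq_of_cons_eq_cons h2
      have h3 := eq_of_heq (Quiver.Path.heq_of_cons_eq_cons h2)
      have h4 : e = e' := eq_of_heq (Quiver.Path.cons.inj h2).2.2
      have h5 := ih (b' := ⟨c, hc⟩) q' (by simp only [h3])
      have h6 : q = q' := by simpa using h5
      rw [h4, h6]

/-- The standard projection `π` from the completed path algebra of a quiver to the one of the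
quiver where some vertices were deleted: it deletes from a series all the paths that pass through a
deleted vertex. So it is the identity on the common vertices and arrows, and it sends all other
vertices and arrows to zero. -/
def proj [Finite V] : CompletedPathAlgebra V →ₐ[ℂ] CompletedPathAlgebra (KeepVertices P) where
  toFun f := ⟨fun a b p => f.1 ((incl P).obj a) ((incl P).obj b) ((incl P).mapPath p), fun n => by
    refine ((f.2 n).preimage (mapPath_injective P).injOn).subset ?_
    rintro ⟨a, b, p⟩ ⟨hn, hp⟩
    exact ⟨(length_mapPath P p).trans hn, hp⟩⟩
  map_one' := by
    ext a b p
    simp [PathSeries.one_apply, length_mapPath]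
  map_mul' f g := by
    ext a b p
    change ((pathSplits ((incl P).mapPath p)).map _).sum = ((pathSplits p).map _).sum
    rw [pathSplits_mapPath, List.map_map]
    rfl
  map_zero' := rfl
  map_add' f g := rfl
  commutes' k := by
    ext a b p
    simp [Algebra.algebraMap_eq_smul_one, PathSeries.one_apply, length_mapPath]

end KeepVertices

/-! ### The local model and the local quiver of an algebra at a semisimple module -/

/-- The completion `lim (A/𝔪 ← A/𝔪² ← ⋯)` of an algebra at a two-sided ideal `𝔪`, as the algebra of
compatible sequences. -/
def adicCompletionAt {A : Type*} [Ring A] [Algebra ℂ A] (m : Ideal A) [m.IsTwoSided] :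
    Subalgebra ℂ (∀ k : ℕ, A ⧸ m ^ k) where
  carrier := {x | ∀ (i j : ℕ) (h : i ≤ j),
    Ideal.Quotient.factor (Ideal.pow_le_pow_right h) (x j) = x i}
  mul_mem' {x y} hx hy i j h := by simp [hx i j h, hy i j h]
  add_mem' {x y} hx hy i j h := by simp [hx i j h, hy i j h]
  algebraMap_mem' c i j h := rfl

/-- The module `T` occurs in `M` (for simple `T`: `T` is a factor of the semisimple module `M`). -/
def OccursIn (A : Type*) [Ring A] (T : Type*) [AddCommGroup T] [Module A T]
    (M : Type*) [AddCommGroup M] [Module A M] : Prop :=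
  ∃ f : T →ₗ[A] M, Function.Injective f

/-- `(S v)` lists the simple factors of the semisimple module `M`, one for each isomorphism
class. -/
structure IsListOfFactors (A : Type*) [Ring A] (M : Type*) [AddCommGroup M] [Module A M]
    {V : Type*} (S : V → Type*) [∀ v, AddCommGroup (S v)] [∀ v, Module A (S v)] : Prop where
  simple : ∀ v, IsSimpleModule A (S v)
  occurs : ∀ v, OccursIn A (S v) M
  distinct : ∀ v w, Nonempty (S v ≃ₗ[A] S w) → v = w
  complete : ∀ T : Submodule A M, IsSimpleModule A T → ∃ v, Nonempty (T ≃ₗ[A] S v)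

open Classical in
/-- `ℂQ̂/I` is the local model `L_M A` of `A` at the semisimple module `M`. Here `𝔪` is the
annihilator of `M`, that is the kernel of `A → End M`, and `Â` is the completion of `A` at `𝔪`.

* The vertices of `Q` correspond to the isomorphism classes of simple factors of `M`, via the
  list `S`.
* `I` is a closed admissible ideal, so that `ℂQ̂/I` is a completed path algebra with relations.
* There is an idempotent `e` of `Â` such that `ℂQ̂/I` is isomorphic to `e Â e`. Under this
  isomorphism each vertex `v` corresponds to an idempotent `ε v` of `Â` (so that `e` is the sum of
  the orthogonal idempotents `ε v`) whose image in the semisimple algebra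
  `A/𝔪 = ∏ End (S w)` is a minimal idempotent of the factor `End (S v)`. Hence `e` contains
  exactly one minimal idempotent for each simple component of `A/𝔪`, and `e Â e` is the basic
  algebra Morita equivalent to `Â`. -/
structure IsLocalModel (A : Type*) [Ring A] [Algebra ℂ A] (M : Type*) [AddCommGroup M] [Module A M]
    {V : Type*} [Finite V] [Quiver V] (S : V → Type*) [∀ v, AddCommGroup (S v)]
    [∀ v, Module ℂ (S v)] [∀ v, Module A (S v)] [∀ v, IsScalarTower ℂ A (S v)]
    (I : Ideal (CompletedPathAlgebra V)) [I.IsTwoSided] : Prop where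
  factors : IsListOfFactors A M S
  closed : IsClosedIdeal I
  admissible : ∀ f ∈ I, DegreeGE 2 f
  basic : ∃ (e : adicCompletionAt (Module.annihilator A M)) (he : IsIdempotentElem e)
    (Ψ : (CompletedPathAlgebra V ⧸ I) ≃+* he.Corner) (ε : V → adicCompletionAt
      (Module.annihilator A M)),
    (∀ (c : ℂ) (x : CompletedPathAlgebra V ⧸ I), (Ψ (c • x)).1 = c • (Ψ x).1) ∧
    (∀ v, (Ψ (Ideal.Quotient.mk I (vertexIdempotent v))).1 = ε v) ∧
    ∀ (v w : V) (a : A), Ideal.Quotient.mk (Module.annihilator A M ^ 1) a = (ε v).1 1 →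
      Module.finrank ℂ (LinearMap.range (Algebra.lsmul ℂ ℂ (S w) a)) = if v = w then 1 else 0

/-- `Q` is the local quiver `Q_M` of `A` at `M`, with vertices labelled by the simple factors of
`M`: the quiver underlying the local model. -/
def IsLocalQuiver (A : Type*) [Ring A] [Algebra ℂ A] (M : Type*) [AddCommGroup M] [Module A M]
    {V : Type*} [Finite V] [Quiver V] (S : V → Type*) [∀ v, AddCommGroup (S v)]
    [∀ v, Module ℂ (S v)] [∀ v, Module A (S v)] [∀ v, IsScalarTower ℂ A (S v)] : Prop :=
  ∃ (I : Ideal (CompletedPathAlgebra V)) (_ : I.IsTwoSided), IsLocalModel A M S I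

end

noncomputable section

set_option linter.unusedSectionVars false

/-! ### Finite-dimensional quotients of finitely generated algebras -/

/-! Write 𝔫 ⊆ 𝔪 for the annihilators of N and M. A local model at N amounts to a non-unital
homomorphism θ from ℂQ̂_N to the completion Â_𝔫 with kernel I = (r_i) and image the corner at e =
θ(1) (`IsCornerPresentation`). The local model at M comes from composing θ with the canonical map
Â_𝔫 → Â_𝔪.

Modulo 𝔫, the ideal 𝔪 is generated by the idempotents ε_v of the deleted vertices
(`annihilator_le_vertexIdeal_sup`). An idempotent in 𝔪/𝔫 lies in every power of it, so 𝔪 ⊆ 𝔫 + 𝔪²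
and Â_𝔫 → Â_𝔪 is surjective (`adicCompletionAt.map_surjective`). The image of a deleted ε_v in Â_𝔪
is an idempotent that vanishes modulo 𝔪, hence is zero. Therefore the composite kills ker π
(`mapSubmodule_eq_zero_of_proj`) and induces a map `restrict` on ℂQ̂_M, again onto a corner.

Its kernel is found by approximation (`restrict_eq_zero_iff`). If g is killed and f extends g by
zero, then modulo each power of 𝔫 the element θ(f) comes from the ideal of the deleted vertices, so
θ(f) ≡ θ(h) with π(h) = 0. Then f - h lies in I up to terms of high degree, and applying π puts g in
π(I) up to terms of high degree. Closedness finishes the argument. For the converse, the kernel is a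
closed ideal containing the π(r_i).

Both directions need the degree filtration on ℂQ̂_N to match, modulo I, the 𝔫-adic one:
`exists_degreeGE_sub` and `coe_eq_zero_of_degreeGE`. This is where finite generation of A enters. It
makes A/𝔫² finite dimensional (`finiteDimensional_quotient_sq`), so the radical of the corner is
finitely generated as a left ideal (`exists_generators`) and the quiver has finitely many arrows.

Finally, the local quiver does not depend on the model, because the number of arrows from v to w is
the dimension of ε_w(𝔪/𝔪²)ε_v (`finrank_arrowSpace`), and idempotents belonging to isomorphic simple
modules are equivalent modulo the radical (`exists_intertwiner`). -/

theorem Ideal.isTwoSided_sup {A : Type*} [Ring A] (I J : Ideal A) [I.IsTwoSided] [J.IsTwoSided] :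
    (I ⊔ J).IsTwoSided :=
  ⟨fun b ha => by
    obtain ⟨x, hx, y, hy, rfl⟩ := Submodule.mem_sup.1 ha
    rw [add_mul]
    exact Submodule.add_mem_sup (I.mul_mem_right b hx) (J.mul_mem_right b hy)⟩

theorem finiteDimensional_quotient_of_fg_sup_eq_top {A : Type*} [Ring A] [Algebra ℂ A]
    (J : Ideal A) [J.IsTwoSided] (W : Submodule ℂ A) (hW : W.FG)
    (h : W ⊔ J.restrictScalars ℂ = ⊤) : FiniteDimensional ℂ (A ⧸ J) := by
  let q : A →ₗ[ℂ] A ⧸ J := (Ideal.Quotient.mkₐ ℂ J).toLinearMap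
  have hq : W.map q = ⊤ := by
    refine eq_top_iff.2 fun y _ => ?_
    obtain ⟨x, rfl⟩ := Ideal.Quotient.mk_surjective y
    obtain ⟨u, hu, z, hz, rfl⟩ := Submodule.mem_sup.1 (h ▸ Submodule.mem_top : x ∈ W ⊔ _)
    refine ⟨u, hu, ?_⟩
    rw [map_add, Ideal.Quotient.eq_zero_iff_mem.2 (show z ∈ J from hz), add_zero]
    rfl
  have := hW.map q
  rw [hq] at this
  exact Module.finite_def.2 this

/-- In a finitely generated algebra the square of an ideal of finite codimension has finite
codimension. -/
theorem finiteDimensional_quotient_sq {A : Type*} [Ring A] [Algebra ℂ A]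
    [Algebra.FiniteType ℂ A] (I : Ideal A) [I.IsTwoSided] [FiniteDimensional ℂ (A ⧸ I)] :
    FiniteDimensional ℂ (A ⧸ I ^ 2) := by
  classical
  obtain ⟨G, hG⟩ := Algebra.FiniteType.out (R := ℂ) (A := A)
  let q : A →ₗ[ℂ] A ⧸ I := (Ideal.Quotient.mkₐ ℂ I).toLinearMap
  have hq : ∀ x, q x = 0 ↔ x ∈ I := fun x => Ideal.Quotient.eq_zero_iff_mem
  have hqs : Function.Surjective q := Ideal.Quotient.mk_surjective
  let n : Submodule ℂ A := I.restrictScalars ℂ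
  obtain ⟨U₀, hU₀, hU₀q⟩ : ∃ U₀ : Submodule ℂ A, U₀.FG ∧ U₀ ⊔ n = ⊤ := by
    obtain ⟨s, hs⟩ := Module.Finite.fg_top (R := ℂ) (M := A ⧸ I)
    choose l hl using hqs
    refine ⟨Submodule.span ℂ (s.image l : Finset A), ⟨_, rfl⟩, ?_⟩
    refine eq_top_iff.2 fun x _ => ?_
    have hx : q x ∈ Submodule.span ℂ (s : Set (A ⧸ I)) := hs ▸ Submodule.mem_top
    have h2 : (Submodule.span ℂ (s.image l : Finset A)).map q = Submodule.span ℂ (s : Set (A ⧸ I)) := by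
      rw [Submodule.map_span, Finset.coe_image, ← Set.image_comp]
      congr 1
      ext y
      simp [hl]
    rw [← h2] at hx
    obtain ⟨y, hy, hyx⟩ := hx
    have : x - y ∈ n := (hq _).1 (by rw [map_sub, hyx, sub_self])
    simpa using Submodule.add_mem_sup hy this
  -- U is a finite dimensional space containing 1, the algebra generators, and a complement of I up
  -- to overlap.
  let U : Submodule ℂ A := U₀ ⊔ Submodule.span ℂ (insert 1 G : Finset A)
  have hU : U.FG := hU₀.sup ⟨_, rfl⟩
  have hUn : U ⊔ n = ⊤ := by
    refine eq_top_iff.2 ?_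
    rw [← hU₀q]
    exact sup_le_sup_right le_sup_left _
  have h1U : (1 : A) ∈ U := Submodule.mem_sup_right (Submodule.subset_span (by simp))
  have hGU : ∀ g ∈ G, g ∈ U := fun g hg =>
    Submodule.mem_sup_right (Submodule.subset_span (by simp [hg]))
  have hUU : (U * U ⊔ U).FG := (hU.mul hU).sup hU
  -- F collects the errors in I made when a product of two elements of U is rewritten as an element
  -- of U.
  let F : Submodule ℂ A := (U * U ⊔ U) ⊓ n
  have hF : F.FG := by
    have : FiniteDimensional ℂ (U * U ⊔ U : Submodule ℂ A) := Module.Finite.iff_fg.2 hUU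
    have : FiniteDimensional ℂ F := Submodule.finiteDimensional_of_le inf_le_left
    exact Module.Finite.iff_fg.1 this
  have hFn : F ≤ n := inf_le_right
  have hmod : ∀ x ∈ U * U ⊔ U, x ∈ U ⊔ F := by
    intro x hx
    obtain ⟨u, hu, y, hy, rfl⟩ := Submodule.mem_sup.1 (hUn ▸ Submodule.mem_top : x ∈ U ⊔ n)
    refine Submodule.add_mem_sup hu ⟨?_, hy⟩
    have := Submodule.sub_mem _ hx (Submodule.mem_sup_right hu : u ∈ U * U ⊔ U)
    simpa using this
  have hTF : (⊤ : Submodule ℂ A) * F * ⊤ ≤ n := by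
    rw [Submodule.mul_le]
    intro a ha b _
    refine I.mul_mem_right b ?_
    revert a
    change (⊤ : Submodule ℂ A) * F ≤ n
    rw [Submodule.mul_le]
    exact fun c _ d hd => I.mul_mem_left c (hFn hd)
  have hF1 : F ≤ ⊤ * F * ⊤ := fun x hx => by
    have := Submodule.mul_mem_mul (Submodule.mul_mem_mul
      (Submodule.mem_top : (1 : A) ∈ (⊤ : Submodule ℂ A)) hx) (Submodule.mem_top : (1 : A) ∈ (⊤ : Submodule ℂ A))
    simpa using this
  -- T contains 1 and is stable under left multiplication by the generators, so it is all of A.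
  -- Hence I is generated by F as a two-sided ideal.
  let T : Submodule ℂ A := U ⊔ ⊤ * F * ⊤
  have hUT : ∀ u ∈ U, ∀ t ∈ T, u * t ∈ T := by
    intro u hu t ht
    obtain ⟨u', hu', y, hy, rfl⟩ := Submodule.mem_sup.1 ht
    rw [mul_add]
    refine T.add_mem ?_ ?_
    · have := hmod _ (Submodule.mem_sup_left (Submodule.mul_mem_mul hu hu'))
      exact sup_le_sup_left hF1 _ this
    · refine Submodule.mem_sup_right ?_
      have : u * y ∈ (⊤ : Submodule ℂ A) * (⊤ * F * ⊤) := Submodule.mul_mem_mul Submodule.mem_top hy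
      rw [← mul_assoc, ← mul_assoc] at this
      exact (mul_le_mul' (mul_le_mul' le_top le_rfl) le_rfl :
        ⊤ * ⊤ * F * ⊤ ≤ ⊤ * F * ⊤) this
  have hT : ∀ a : A, ∀ t ∈ T, a * t ∈ T := by
    intro a
    have ha : a ∈ Algebra.adjoin ℂ (G : Set A) := hG ▸ Algebra.mem_top
    induction ha using Algebra.adjoin_induction with
    | mem x hx => exact hUT x (hGU x hx)
    | algebraMap r =>
      intro t ht
      rw [← Algebra.smul_def]
      exact T.smul_mem r ht
    | add x y _ _ hx hy => intro t ht; rw [add_mul]; exact T.add_mem (hx t ht) (hy t ht)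
    | mul x y _ _ hx hy => intro t ht; rw [mul_assoc]; exact hx _ (hy t ht)
  have hTtop : T = ⊤ := by
    refine eq_top_iff.2 fun a _ => ?_
    simpa using hT a 1 (Submodule.mem_sup_left h1U)
  -- In AFA replace both outer factors by U + I. As F ⊆ I, every term with a factor from I falls
  -- into I², leaving the finite dimensional UFU.
  have hn : n ≤ U * F * U ⊔ (I ^ 2).restrictScalars ℂ := by
    have h2 : ⊤ * F * ⊤ ≤ U * F * U ⊔ (I ^ 2).restrictScalars ℂ := by
      rw [Submodule.mul_le]
      intro a ha b _
      obtain ⟨b, hb, b', hb', rfl⟩ := Submodule.mem_sup.1 (hUn ▸ Submodule.mem_top : b ∈ U ⊔ n)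
      rw [mul_add]
      refine Submodule.add_mem _ ?_ (Submodule.mem_sup_right ?_)
      · revert a
        change (⊤ : Submodule ℂ A) * F ≤ Submodule.comap (LinearMap.mulRight ℂ b)
          (U * F * U ⊔ (I ^ 2).restrictScalars ℂ)
        rw [Submodule.mul_le]
        intro a _ f hf
        obtain ⟨a, ha, a', ha', rfl⟩ := Submodule.mem_sup.1 (hUn ▸ Submodule.mem_top : a ∈ U ⊔ n)
        rw [add_mul]
        refine Submodule.add_mem _ (Submodule.mem_sup_left ?_) (Submodule.mem_sup_right ?_)
        · exact Submodule.mul_mem_mul (Submodule.mul_mem_mul ha hf) hb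
        · change a' * f * b ∈ I ^ 2
          rw [Submodule.pow_succ, Submodule.pow_one]
          exact Ideal.mul_mem_right _ _ (Ideal.mul_mem_mul ha' (hFn hf))
      · change a * b' ∈ I ^ 2
        rw [Submodule.pow_succ, Submodule.pow_one]
        have hay := hTF (Submodule.mul_mem_mul ha (Submodule.mem_top : (1 : A) ∈ (⊤ : Submodule ℂ A)))
        rw [mul_one] at hay
        exact Ideal.mul_mem_mul hay hb'
    intro x hx
    obtain ⟨u, hu, y, hy, rfl⟩ := Submodule.mem_sup.1 (hTtop ▸ Submodule.mem_top : x ∈ T)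
    have hun : u ∈ n := by simpa using n.sub_mem hx (hTF hy)
    exact Submodule.add_mem _ (h2 (hF1 ⟨Submodule.mem_sup_right hu, hun⟩)) (h2 hy)
  have htop : ⊤ ≤ (U ⊔ U * F * U) ⊔ (I ^ 2).restrictScalars ℂ := by
    rw [← hUn, sup_le_iff]
    exact ⟨le_sup_left.trans le_sup_left, hn.trans (sup_le_sup_right le_sup_right _)⟩
  have hfg : (U ⊔ U * F * U).FG := hU.sup ((hU.mul hF).mul hU)
  exact finiteDimensional_quotient_of_fg_sup_eq_top _ _ hfg (top_le_iff.1 htop)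

instance Module.finiteDimensional_quotient_annihilator (A : Type*) [Ring A] [Algebra ℂ A] (N : Type*)
    [AddCommGroup N] [Module ℂ N] [Module A N] [IsScalarTower ℂ A N] [FiniteDimensional ℂ N] :
    FiniteDimensional ℂ (A ⧸ Module.annihilator A N) := by
  have h : ∀ a ∈ Module.annihilator A N, Algebra.lsmul ℂ ℂ N a = 0 := fun a ha => by
    ext x
    exact Module.mem_annihilator.1 ha x
  refine Module.Finite.of_injective (Ideal.Quotient.liftₐ _ (Algebra.lsmul ℂ ℂ N) h).toLinearMap ?_
  refine (injective_iff_map_eq_zero _).2 fun x hx => ?_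
  obtain ⟨a, rfl⟩ := Ideal.Quotient.mk_surjective x
  refine Ideal.Quotient.eq_zero_iff_mem.2 (Module.mem_annihilator.2 fun y => ?_)
  exact LinearMap.congr_fun hx y

/-! ### Annihilators of semisimple modules -/

/-- A two-sided ideal containing the annihilator of `N` and acting nontrivially on each simple
submodule of `N` that does not occur in `M` contains the annihilator of `M`. -/
theorem annihilator_le_of_smul_ne_zero {A : Type*} [Ring A] [Algebra ℂ A] {N : Type*} [AddCommGroup N]
    [Module ℂ N] [Module A N] [IsScalarTower ℂ A N] [FiniteDimensional ℂ N] [IsSemisimpleModule A N]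
    {M : Type*} [AddCommGroup M] [Module A M] (X : Ideal A) [X.IsTwoSided]
    (hX : Module.annihilator A N ≤ X)
    (hT : ∀ T : Submodule A N, IsSimpleModule A T → ¬ OccursIn A T M → ∃ a ∈ X, ∃ t : T, a • t ≠ 0) :
    Module.annihilator A M ≤ X := by
  let b := Module.finBasis ℂ N
  -- An element killing a ℂ-basis of N annihilates N, so g embeds A modulo the annihilator of N into
  -- a finite power of N.
  let g : A →ₗ[A] (Fin (Module.finrank ℂ N) → N) := LinearMap.pi fun i => LinearMap.toSpanSingleton A N (b i)
  have hg : LinearMap.ker g ≤ X := by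
    refine le_trans (fun a ha => Module.mem_annihilator.2 fun n => ?_) hX
    have hb : ∀ i, a • b i = 0 := fun i => congrFun (LinearMap.mem_ker.1 ha) i
    have : Algebra.lsmul ℂ ℂ N a = 0 := b.ext fun i => hb i
    exact LinearMap.congr_fun this n
  let R := LinearMap.range g
  -- A/X is a quotient of the semisimple module R, hence splits off. Each simple submodule of A/X
  -- therefore embeds into N through some coordinate.
  let p : R →ₗ[A] A ⧸ X :=
    ((LinearMap.ker g).liftQ X.mkQ (by rwa [Submodule.ker_mkQ])).comp
      g.quotKerEquivRange.symm.toLinearMap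
  have hp : Function.Surjective p := by
    intro y
    obtain ⟨a, rfl⟩ := X.mkQ_surjective y
    refine ⟨g.quotKerEquivRange (Submodule.Quotient.mk a), ?_⟩
    simp only [p, LinearMap.comp_apply, LinearEquiv.coe_coe, LinearEquiv.symm_apply_apply]
    exact Submodule.liftQ_apply _ _ _
  obtain ⟨s, hs⟩ := IsSemisimpleModule.lifting_property p hp LinearMap.id
  have hs' : Function.Injective s := fun x y h => by
    rw [← LinearMap.id_apply (R := A) x, ← LinearMap.id_apply (R := A) y, ← hs]
    simp [h]
  have hss : IsSemisimpleModule A (A ⧸ X) := IsSemisimpleModule.of_injective s hs'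
  have hmem : ∀ a ∈ Module.annihilator A M, ∀ y : A ⧸ X, a • y = 0 := by
    intro a ha y
    have htop := IsSemisimpleModule.sSup_simples_eq_top A (A ⧸ X)
    have hy : y ∈ sSup {m : Submodule A (A ⧸ X) | IsSimpleModule A m} := htop ▸ Submodule.mem_top
    rw [sSup_eq_iSup'] at hy
    induction hy using Submodule.iSup_induction' with
    | zero => simp
    | add x y _ _ hx hy => rw [smul_add, hx, hy, add_zero]
    | mem T x hx =>
      obtain ⟨T, hTs⟩ := T
      have : IsSimpleModule A T := hTs
      obtain ⟨i, hi⟩ : ∃ i, (LinearMap.proj i).comp (R.subtype.comp (s.comp T.subtype)) ≠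
          (0 : T →ₗ[A] N) := by
        by_contra! h
        have h0 : ∀ t : T, t = 0 := fun t => by
          have : s t.1 = 0 := Subtype.ext (funext fun i => LinearMap.congr_fun (h i) t)
          exact Subtype.ext (hs' (by rw [this, ZeroMemClass.coe_zero, map_zero]))
        have := IsSimpleModule.nontrivial A T
        obtain ⟨t, ht⟩ := exists_ne (0 : T)
        exact ht (h0 t)
      set f := (LinearMap.proj i).comp (R.subtype.comp (s.comp T.subtype)) with hf
      have hfi : Function.Injective f := (LinearMap.injective_or_eq_zero f).resolve_right hi
      let E := LinearEquiv.ofInjective f hfi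
      have hsr : IsSimpleModule A (LinearMap.range f) := IsSimpleModule.congr E.symm
      by_cases hocc : OccursIn A (LinearMap.range f) M
      · obtain ⟨j, hj⟩ := hocc
        have hz : a • (⟨x, hx⟩ : T) = 0 := by
          apply E.injective
          apply hj
          rw [map_smul, map_smul, Module.mem_annihilator.1 ha, map_zero, map_zero]
        exact congrArg Subtype.val hz
      · obtain ⟨c, hc, t, ht⟩ := hT _ hsr hocc
        refine absurd ?_ ht
        obtain ⟨t', rfl⟩ := E.surjective t
        rw [← map_smul]
        -- X is two-sided and so kills A/X. A simple submodule of A/X on which X acts nontrivially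
        -- is thus impossible.
        have : c • t' = 0 := Subtype.ext (by
          obtain ⟨⟨y⟩, hy⟩ := t'
          change Submodule.Quotient.mk (c * y) = (0 : A ⧸ X)
          exact (Submodule.Quotient.mk_eq_zero X).2 (X.mul_mem_right y hc))
        rw [this, map_zero]
  intro a ha
  have := hmem a ha (Submodule.Quotient.mk 1)
  rw [← Submodule.Quotient.mk_smul, smul_eq_mul, mul_one] at this
  exact (Submodule.Quotient.mk_eq_zero X).1 this

/-- If `m ≤ X + n` with two-sided ideals, then `m ^ k ≤ X + n ^ k`. -/
theorem Ideal.pow_le_sup_pow {A : Type*} [Ring A] (m n X : Ideal A) [X.IsTwoSided]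
    (h : m ≤ X ⊔ n) (k : ℕ) : m ^ k ≤ X ⊔ n ^ k := by
  induction k with
  | zero => rw [Submodule.pow_zero, Submodule.pow_zero]; exact le_sup_right
  | succ k ih =>
    have h1 : (X ⊔ n ^ k) * X ≤ X := Ideal.mul_le_right
    have h2 : X * n ≤ X := Ideal.mul_le_left
    have h3 : (X ⊔ n ^ k) * (X ⊔ n) ≤ X ⊔ n ^ k * n := by
      rw [Ideal.mul_sup, Ideal.sup_mul _ _ n]
      exact sup_le (h1.trans le_sup_left) (sup_le (h2.trans le_sup_left) le_sup_right)
    rw [Submodule.pow_succ, Submodule.pow_succ]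
    exact (Ideal.mul_mono ih h).trans h3

/-- In the product of 𝔫^k + 𝔪^(k+1) with 𝔫 + 𝔪², every term except 𝔫^k·𝔫 lies in 𝔪^(k+2). This lets
successive approximations in the 𝔪-adic completion be corrected by elements of 𝔫^k. -/
theorem Ideal.pow_le_pow_sup_pow_succ {A : Type*} [Ring A] (m n : Ideal A) [m.IsTwoSided] [n.IsTwoSided]
    (hnm : n ≤ m) (h : m ≤ n ⊔ m ^ 2) (k : ℕ) : m ^ k ≤ n ^ k ⊔ m ^ (k + 1) := by
  induction k with
  | zero => rw [Submodule.pow_zero, Submodule.pow_zero]; exact le_sup_left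
  | succ k ih =>
    have h1 : n ^ k * m ^ 2 ≤ m ^ (k + 2) := by
      rw [Ideal.IsTwoSided.pow_add]
      exact Ideal.mul_mono (Ideal.pow_right_mono hnm k) le_rfl
    have h2 : m ^ (k + 1) * n ≤ m ^ (k + 2) := by
      rw [Submodule.pow_succ m]
      exact Ideal.mul_mono le_rfl hnm
    have h3 : m ^ (k + 1) * m ^ 2 ≤ m ^ (k + 2) := by
      rw [← Ideal.IsTwoSided.pow_add]
      exact Ideal.pow_le_pow_right (by omega)
    rw [Submodule.pow_succ m]
    refine (Ideal.mul_mono ih h).trans ?_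
    rw [Ideal.sup_mul, Ideal.mul_sup, Ideal.mul_sup]
    refine sup_le (sup_le ?_ (h1.trans le_sup_right)) (sup_le (h2.trans le_sup_right) (h3.trans le_sup_right))
    rw [← Submodule.pow_succ]
    exact le_sup_left

/-! ### Degrees and coefficients in completed path algebras -/

namespace CompletedPathAlgebra

variable {V : Type*} [Finite V] [Quiver V]

theorem ext_coeff {f g : CompletedPathAlgebra V} (h : ∀ a b (p : Quiver.Path a b), f.1 a b p = g.1 a b p) :
    f = g :=
  Subtype.ext (PathSeries.ext h)

theorem coeff_sum {κ : Type*} (s : Finset κ) (f : κ → CompletedPathAlgebra V) {a b : V}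
    (p : Quiver.Path a b) : (∑ i ∈ s, f i).1 a b p = ∑ i ∈ s, (f i).1 a b p := by
  classical
  induction s using Finset.induction_on with
  | empty => rfl
  | insert i s hi ih =>
    rw [Finset.sum_insert hi, Finset.sum_insert hi, ← ih]
    rfl

@[simp] theorem coeff_add (f g : CompletedPathAlgebra V) {a b : V} (p : Quiver.Path a b) :
    (f + g).1 a b p = f.1 a b p + g.1 a b p := rfl

@[simp] theorem coeff_sub (f g : CompletedPathAlgebra V) {a b : V} (p : Quiver.Path a b) :
    (f - g).1 a b p = f.1 a b p - g.1 a b p := rfl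

@[simp] theorem coeff_zero {a b : V} (p : Quiver.Path a b) :
    (0 : CompletedPathAlgebra V).1 a b p = 0 := rfl

@[simp] theorem coeff_smul (c : ℂ) (f : CompletedPathAlgebra V) {a b : V} (p : Quiver.Path a b) :
    (c • f).1 a b p = c * f.1 a b p := rfl

theorem coeff_mul (f g : CompletedPathAlgebra V) {a b : V} (p : Quiver.Path a b) :
    (f * g).1 a b p = PathSeries.conv (fun x r => f.1 x b r) (fun x r => g.1 a x r) p := rfl

theorem coeff_mul_toPath (f g : CompletedPathAlgebra V) {v w : V} (e : v ⟶ w) :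
    (f * g).1 v w e.toPath =
      f.1 w w Quiver.Path.nil * g.1 v w e.toPath + f.1 v w e.toPath * g.1 v v Quiver.Path.nil := by
  rw [coeff_mul, Quiver.Hom.toPath, PathSeries.conv_cons, PathSeries.conv_nil]

theorem coeff_vertexIdempotent [DecidableEq V] (v : V) {a b : V} (p : Quiver.Path a b) :
    (vertexIdempotent v).1 a b p = if a = v ∧ p.length = 0 then 1 else 0 := by
  simp only [vertexIdempotent]
  split_ifs <;> rfl

theorem coeff_vertexIdempotent_mul [DecidableEq V] (v : V) (f : CompletedPathAlgebra V) {a b : V}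
    (p : Quiver.Path a b) :
    (vertexIdempotent v * f).1 a b p = if b = v then f.1 a b p else 0 := by
  rw [coeff_mul]
  have : (fun x (r : Quiver.Path x b) => (vertexIdempotent v).1 x b r) =
      fun x r => (if b = v then 1 else 0) * (1 : PathSeries V) x b r := by
    funext x r
    rw [coeff_vertexIdempotent, PathSeries.one_apply]
    cases r with
    | nil => simp
    | cons => simp
  rw [this, PathSeries.conv_smul_left, PathSeries.conv_one_left]
  split_ifs <;> simp

theorem coeff_mul_vertexIdempotent [DecidableEq V] (v : V) (f : CompletedPathAlgebra V) {a b : V}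
    (p : Quiver.Path a b) :
    (f * vertexIdempotent v).1 a b p = if a = v then f.1 a b p else 0 := by
  rw [coeff_mul]
  by_cases h : a = v
  · rw [if_pos h]
    have : (fun x (r : Quiver.Path a x) => (vertexIdempotent v).1 a x r) =
        fun x r => (1 : PathSeries V) a x r := by
      funext x r
      rw [coeff_vertexIdempotent, PathSeries.one_apply]
      simp [h]
    rw [this, PathSeries.conv_one_right]
  · rw [if_neg h]
    have : (fun x (r : Quiver.Path a x) => (vertexIdempotent v).1 a x r) = fun x r => 0 := by
      funext x r
      rw [coeff_vertexIdempotent]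
      simp [h]
    rw [this]
    simp [PathSeries.conv]

theorem vertexIdempotent_mul_self (v : V) :
    vertexIdempotent v * vertexIdempotent v = (vertexIdempotent v : CompletedPathAlgebra V) := by
  classical
  refine ext_coeff fun a b p => ?_
  rw [coeff_mul_vertexIdempotent, coeff_vertexIdempotent]
  by_cases h : a = v <;> simp [h]

theorem sum_vertexIdempotent [Fintype V] :
    ∑ v, vertexIdempotent v = (1 : CompletedPathAlgebra V) := by
  classical
  refine ext_coeff fun a b p => ?_
  rw [coeff_sum]
  simp only [coeff_vertexIdempotent]
  change _ = (1 : PathSeries V) a b p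
  rw [PathSeries.one_apply]
  by_cases h : p.length = 0 <;> simp [h]

end CompletedPathAlgebra

open CompletedPathAlgebra

namespace DegreeGE

variable {V : Type*} [Finite V] [Quiver V] {n : ℕ} {f g : CompletedPathAlgebra V}

protected theorem zero (n : ℕ) : DegreeGE n (0 : CompletedPathAlgebra V) := fun _ _ _ _ => rfl

theorem add (hf : DegreeGE n f) (hg : DegreeGE n g) : DegreeGE n (f + g) := fun a b p hp => by
  simp [hf a b p hp, hg a b p hp]

theorem sub (hf : DegreeGE n f) (hg : DegreeGE n g) : DegreeGE n (f - g) := fun a b p hp => by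
  simp [hf a b p hp, hg a b p hp]

theorem smul (c : ℂ) (hf : DegreeGE n f) : DegreeGE n (c • f) := fun a b p hp => by
  simp [hf a b p hp]

theorem mono {m : ℕ} (h : m ≤ n) (hf : DegreeGE n f) : DegreeGE m f := fun a b p hp =>
  hf a b p (hp.trans_le h)

theorem sum {κ : Type*} (s : Finset κ) (f : κ → CompletedPathAlgebra V) (hf : ∀ i ∈ s, DegreeGE n (f i)) :
    DegreeGE n (∑ i ∈ s, f i) := fun a b p hp => by
  rw [coeff_sum]
  exact Finset.sum_eq_zero fun i hi => hf i hi a b p hp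

theorem mul {m : ℕ} (hf : DegreeGE m f) (hg : DegreeGE n g) : DegreeGE (m + n) (f * g) := by
  intro a b p hp
  refine List.sum_eq_zero fun x hx => ?_
  obtain ⟨s, hs, rfl⟩ := List.mem_map.1 hx
  have hl : s.2.1.length + s.2.2.length = p.length := by
    rw [← Quiver.Path.length_comp, comp_of_mem_pathSplits p s hs]
  by_cases h : s.2.2.length < m
  · rw [hf _ _ _ h, zero_mul]
  · rw [hg _ _ _ (by omega), mul_zero]

theorem of_zero (f : CompletedPathAlgebra V) : DegreeGE 0 f := fun _ _ _ h => absurd h (Nat.not_lt_zero _)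

theorem mul_left (f : CompletedPathAlgebra V) (hg : DegreeGE n g) : DegreeGE n (f * g) := by
  simpa using (of_zero f).mul hg

theorem mul_right (g : CompletedPathAlgebra V) (hf : DegreeGE n f) : DegreeGE n (f * g) := by
  simpa using hf.mul (of_zero g)

theorem pow (hf : DegreeGE 1 f) (k : ℕ) : DegreeGE k (f ^ k) := by
  induction k with
  | zero => exact of_zero _
  | succ k ih => rw [pow_succ]; exact ih.mul hf

theorem eq_zero (h : ∀ n, DegreeGE n f) : f = 0 :=
  ext_coeff fun a b p => h (p.length + 1) a b p (Nat.lt_succ_self _)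

/-- Geometric series. -/
theorem exists_mul_one_sub_eq_one (hf : DegreeGE 1 f) : ∃ g, g * (1 - f) = 1 := by
  let G : ℕ → CompletedPathAlgebra V := fun N => ∑ i ∈ Finset.range (N + 1), f ^ i
  have hG : ∀ {a b : V} (p : Quiver.Path a b) (N : ℕ), p.length ≤ N →
      (G N).1 a b p = (G p.length).1 a b p := by
    intro a b p N hN
    induction N, hN using Nat.le_induction with
    | base => rfl
    | succ N hN ih =>
      rw [← ih]
      simp only [G]
      rw [Finset.sum_range_succ _ (N + 1), coeff_add, hf.pow (N + 1) a b p (by omega), add_zero]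
  -- Powers of f beyond the length of p do not reach p, so its coefficient is already final in the
  -- partial sum of index `p.length`.
  let g : CompletedPathAlgebra V := ⟨fun a b p => (G p.length).1 a b p, fun n => by
    refine ((G n).2 n).subset ?_
    rintro ⟨a, b, p⟩ ⟨rfl, h⟩
    exact ⟨rfl, h⟩⟩
  have hg : ∀ N, DegreeGE (N + 1) (g - G N) := fun N a b p hp => by
    rw [coeff_sub, hG p N (by omega)]
    exact sub_self _
  refine ⟨g, sub_eq_zero.1 (eq_zero fun N => ?_)⟩
  have h1 : g * (1 - f) - 1 = (g - G N) * (1 - f) - f ^ (N + 1) := by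
    rw [sub_mul, show G N * (1 - f) = 1 - f ^ (N + 1) from geom_sum_mul_neg f (N + 1)]
    abel
  rw [h1]
  exact mono (Nat.le_succ N) (((hg N).mul_right _).sub (hf.pow _))

theorem sub_sum_vertexIdempotent [Fintype V] (f : CompletedPathAlgebra V) :
    DegreeGE 1 (f - ∑ v, f.1 v v Quiver.Path.nil • vertexIdempotent v) := by
  classical
  intro a b p hp
  have h0 : p.length = 0 := by omega
  obtain rfl := Quiver.Path.eq_of_length_zero p h0
  obtain rfl := Quiver.Path.eq_nil_of_length_zero p h0
  rw [coeff_sub, coeff_sum]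
  simp [coeff_vertexIdempotent]

theorem one_iff : DegreeGE 1 f ↔ ∀ v, f.1 v v Quiver.Path.nil = 0 := by
  refine ⟨fun h v => h v v _ Nat.one_pos, fun h a b p hp => ?_⟩
  have h0 : p.length = 0 := by omega
  obtain rfl := Quiver.Path.eq_of_length_zero p h0
  obtain rfl := Quiver.Path.eq_nil_of_length_zero p h0
  exact h a

end DegreeGE

/-! ### Arrows and division by a last arrow -/

namespace CompletedPathAlgebra

variable {V : Type*} [Finite V] [Quiver V]

open Classical in
/-- An arrow as an element of the completed path algebra. -/
def arrow {v w : V} (e : v ⟶ w) : CompletedPathAlgebra V :=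
  ⟨fun a b p => if (⟨a, b, p⟩ : Σ a b : V, Quiver.Path a b) = ⟨v, w, e.toPath⟩ then 1 else 0, fun n => by
    refine (Set.finite_singleton (⟨v, w, e.toPath⟩ : Σ a b : V, Quiver.Path a b)).subset ?_
    rintro ⟨a, b, p⟩ ⟨-, hp⟩
    by_contra h
    exact hp (if_neg h)⟩

open Classical in
theorem coeff_arrow {v w : V} (e : v ⟶ w) {a b : V} (p : Quiver.Path a b) :
    (arrow e).1 a b p = if (⟨a, b, p⟩ : Σ a b : V, Quiver.Path a b) = ⟨v, w, e.toPath⟩ then 1 else 0 := rfl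

theorem degreeGE_arrow {v w : V} (e : v ⟶ w) : DegreeGE 1 (arrow e) := by
  intro a b p hp
  rw [coeff_arrow, if_neg]
  intro h
  have := congrArg (fun z : Σ a b : V, Quiver.Path a b => z.2.2.length) h
  simp only [Quiver.Hom.toPath, Quiver.Path.length_cons, Quiver.Path.length_nil] at this
  omega

theorem coeff_arrow_toPath {v w : V} [DecidableEq (v ⟶ w)] (e e' : v ⟶ w) :
    (arrow e).1 v w e'.toPath = if e' = e then 1 else 0 := by
  classical
  rw [coeff_arrow]
  refine if_congr ⟨fun h => ?_, fun h => h ▸ rfl⟩ rfl rfl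
  have h1 := eq_of_heq (Sigma.mk.inj h).2
  have h2 := eq_of_heq (Sigma.mk.inj h1).2
  exact eq_of_heq (Quiver.Path.cons.inj h2).2.2

theorem vertexIdempotent_mul_arrow {v w : V} (e : v ⟶ w) : vertexIdempotent w * arrow e = arrow e := by
  classical
  refine ext_coeff fun a b p => ?_
  rw [coeff_vertexIdempotent_mul, coeff_arrow]
  split_ifs with h1 h2 h2
  · rfl
  · rfl
  · exact absurd (congrArg (fun z : Σ a b : V, Quiver.Path a b => z.2.1) h2) h1
  · rfl

theorem arrow_mul_vertexIdempotent {v w : V} (e : v ⟶ w) : arrow e * vertexIdempotent v = arrow e := by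
  classical
  refine ext_coeff fun a b p => ?_
  rw [coeff_mul_vertexIdempotent, coeff_arrow]
  split_ifs with h1 h2 h2
  · rfl
  · rfl
  · exact absurd (congrArg (fun z : Σ a b : V, Quiver.Path a b => z.1) h2) h1
  · rfl

theorem coeff_arrow_mul_nil {v w : V} (e : v ⟶ w) (f : CompletedPathAlgebra V) (a : V) :
    (arrow e * f).1 a a Quiver.Path.nil = 0 :=
  ((degreeGE_arrow e).mul_right f) a a _ Nat.one_pos

open Classical in
theorem coeff_arrow_mul_cons {v w : V} (e : v ⟶ w) (f : CompletedPathAlgebra V) {a b c : V}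
    (p : Quiver.Path a b) (e' : b ⟶ c) :
    (arrow e * f).1 a c (p.cons e') =
      if (⟨v, w, e⟩ : Σ v w : V, (v ⟶ w)) = ⟨b, c, e'⟩ then f.1 a b p else 0 := by
  rw [coeff_mul, PathSeries.conv_cons, degreeGE_arrow e c c Quiver.Path.nil Nat.one_pos, zero_mul, zero_add]
  split_ifs with h
  · obtain rfl : v = b := congrArg Sigma.fst h
    have h1 := eq_of_heq (Sigma.mk.inj h).2
    obtain rfl : w = c := congrArg Sigma.fst h1
    obtain rfl : e = e' := eq_of_heq (Sigma.mk.inj h1).2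
    have : (fun x (r : Quiver.Path x v) => (arrow e).1 x w (r.cons e)) =
        fun x r => (1 : PathSeries V) x v r := by
      funext x r
      rw [PathSeries.one_apply]
      cases r with
      | nil => exact (if_pos rfl).trans (if_pos rfl).symm
      | cons q e' =>
        rw [coeff_arrow, if_neg, if_neg (by simp)]
        intro h
        have := congrArg (fun z : Σ a b : V, Quiver.Path a b => z.2.2.length) h
        simp [Quiver.Hom.toPath] at this
    rw [this, PathSeries.conv_one_left]
  · have : (fun x (r : Quiver.Path x b) => (arrow e).1 x c (r.cons e')) = fun x r => 0 := by
      funext x r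
      rw [coeff_arrow, if_neg]
      intro h'
      refine h ?_
      obtain rfl : x = v := congrArg Sigma.fst h'
      have h1 := eq_of_heq (Sigma.mk.inj h').2
      obtain rfl : c = w := congrArg Sigma.fst h1
      have h2 : r.cons e' = Quiver.Path.nil.cons e := eq_of_heq (Sigma.mk.inj h1).2
      obtain rfl := Quiver.Path.obj_eq_of_cons_eq_cons h2
      obtain rfl : e' = e := eq_of_heq (Quiver.Path.cons.inj h2).2.2
      rfl
    rw [this, PathSeries.conv_zero_left]

open Classical in
/-- The series `g` such that `e g` is the part of `f` supported on the paths with last arrow `e`. -/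
def cancelArrow {v w : V} (e : v ⟶ w) (f : CompletedPathAlgebra V) : CompletedPathAlgebra V :=
  ⟨fun a b p => if h : b = v then f.1 a w ((h ▸ p : Quiver.Path a v).cons e) else 0, fun n => by
    let i : (Σ a b : V, Quiver.Path a b) → Σ a b : V, Quiver.Path a b := fun p =>
      if h : p.2.1 = v then ⟨p.1, w, (h ▸ p.2.2 : Quiver.Path p.1 v).cons e⟩ else p
    -- Appending e raises the length by one and is injective on paths ending at v, so finiteness in
    -- length n follows from that of f in length n + 1.
    refine Set.Finite.of_finite_image (f := i) ((f.2 (n + 1)).subset ?_) ?_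
    · rintro _ ⟨⟨a, b, p⟩, ⟨rfl, hp⟩, rfl⟩
      by_cases h : b = v
      · subst h
        simp only [dite_true] at hp
        simp only [i, dite_true]
        exact ⟨rfl, hp⟩
      · simp [h] at hp
    · rintro ⟨a, b, p⟩ ⟨-, hp⟩ ⟨a', b', p'⟩ ⟨-, hp'⟩ h
      by_cases hb : b = v
      · by_cases hb' : b' = v
        · subst hb hb'
          simp only [i, dite_true] at h
          obtain rfl : a = a' := congrArg Sigma.fst h
          have h1 := eq_of_heq (Sigma.mk.inj h).2
          have h2 := eq_of_heq (Sigma.mk.inj h1).2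
          obtain rfl := eq_of_heq (Quiver.Path.heq_of_cons_eq_cons h2)
          rfl
        · simp [hb'] at hp'
      · simp [hb] at hp⟩

theorem coeff_cancelArrow {v w : V} (e : v ⟶ w) (f : CompletedPathAlgebra V) {a : V}
    (p : Quiver.Path a v) : (cancelArrow e f).1 a v p = f.1 a w (p.cons e) := by
  simp [cancelArrow]

theorem coeff_cancelArrow_of_ne {v w : V} (e : v ⟶ w) (f : CompletedPathAlgebra V) {a b : V}
    (p : Quiver.Path a b) (h : b ≠ v) : (cancelArrow e f).1 a b p = 0 := by
  simp [cancelArrow, h]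

theorem degreeGE_cancelArrow {v w : V} (e : v ⟶ w) {f : CompletedPathAlgebra V} {n : ℕ}
    (hf : DegreeGE (n + 1) f) : DegreeGE n (cancelArrow e f) := by
  intro a b p hp
  by_cases h : b = v
  · subst h
    rw [coeff_cancelArrow]
    exact hf _ _ _ (by simpa using hp)
  · exact coeff_cancelArrow_of_ne e f p h

/-- A path of positive length has a unique last arrow. With finitely many arrows this sorts f into a
finite sum, so inductions over the filtration can peel off one arrow at a time. -/
theorem eq_sum_arrow_mul [Fintype V] [Fintype (Σ v w : V, (v ⟶ w))] (f : CompletedPathAlgebra V) :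
    f = ∑ v, f.1 v v Quiver.Path.nil • vertexIdempotent v +
      ∑ e : Σ v w : V, (v ⟶ w), arrow e.2.2 * cancelArrow e.2.2 f := by
  classical
  refine ext_coeff fun a b p => ?_
  rw [coeff_add, coeff_sum, coeff_sum]
  cases p with
  | nil =>
    simp only [coeff_arrow_mul_nil, Finset.sum_const_zero, add_zero]
    simp [coeff_vertexIdempotent]
  | @cons d _ p e =>
    have h1 : ∀ x : Σ v w : V, (v ⟶ w), (arrow x.2.2 * cancelArrow x.2.2 f).1 a b (p.cons e) =
        if x = ⟨d, b, e⟩ then (cancelArrow x.2.2 f).1 a d p else 0 := fun x =>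
      coeff_arrow_mul_cons _ _ _ _
    simp only [h1]
    rw [Finset.sum_ite_eq' Finset.univ (⟨d, b, e⟩ : Σ v w : V, (v ⟶ w))]
    simp [coeff_vertexIdempotent, coeff_cancelArrow]

end CompletedPathAlgebra

/-! ### The standard projection and extension by zero -/

namespace KeepVertices

variable {V : Type*} (P : V → Prop) [Quiver V] [Finite V]

theorem coeff_proj (f : CompletedPathAlgebra V) {a b : KeepVertices P} (p : Quiver.Path a b) :
    (proj P f).1 a b p = f.1 _ _ ((incl P).mapPath p) := rfl

theorem degreeGE_proj {n : ℕ} {f : CompletedPathAlgebra V} (hf : DegreeGE n f) :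
    DegreeGE n (proj P f) := fun a b p hp =>
  hf _ _ _ (by rwa [length_mapPath])

theorem proj_vertexIdempotent_of_not {v : V} (hv : ¬ P v) : proj P (vertexIdempotent v) = 0 := by
  classical
  refine ext_coeff fun a b p => ?_
  rw [coeff_proj, coeff_vertexIdempotent, if_neg, coeff_zero]
  rintro ⟨h, -⟩
  exact hv (h ▸ a.property)

theorem proj_vertexIdempotent (v : KeepVertices P) :
    proj P (vertexIdempotent v.val) = vertexIdempotent v := by
  classical
  refine ext_coeff fun a b p => ?_
  rw [coeff_proj, coeff_vertexIdempotent, coeff_vertexIdempotent, length_mapPath]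
  refine if_congr (and_congr_left fun _ => ⟨fun h => ?_, fun h => h ▸ rfl⟩) rfl rfl
  obtain ⟨a, _⟩ := a
  obtain ⟨v, _⟩ := v
  obtain rfl : a = v := h
  rfl

/-- The image in `V` of a path between remaining vertices. -/
def inclPath (p : Σ a b : KeepVertices P, Quiver.Path a b) : Σ a b : V, Quiver.Path a b :=
  ⟨(incl P).obj p.1, (incl P).obj p.2.1, (incl P).mapPath p.2.2⟩

open Classical in
/-- Extension by zero of a series on the remaining quiver. -/
def extend (g : CompletedPathAlgebra (KeepVertices P)) : CompletedPathAlgebra V :=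
  ⟨fun a b p => if h : ∃ q, inclPath P q = ⟨a, b, p⟩ then g.1 _ _ h.choose.2.2 else 0, fun n => by
    refine ((g.2 n).image (inclPath P)).subset ?_
    rintro ⟨a, b, p⟩ ⟨hn, hp⟩
    by_cases h : ∃ q, inclPath P q = ⟨a, b, p⟩
    · refine ⟨h.choose, ⟨?_, by simpa only [dif_pos h] using hp⟩, h.choose_spec⟩
      have h1 := congrArg (fun z : Σ a b : V, Quiver.Path a b => z.2.2.length) h.choose_spec
      rw [← hn, ← h1]
      exact (length_mapPath P _).symm
    · simp only [dif_neg h] at hp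
      exact absurd rfl hp⟩

theorem proj_extend (g : CompletedPathAlgebra (KeepVertices P)) : proj P (extend P g) = g := by
  classical
  refine ext_coeff fun a b p => ?_
  have h : ∃ q, inclPath P q = ⟨_, _, (incl P).mapPath p⟩ := ⟨⟨a, b, p⟩, rfl⟩
  have h1 : h.choose = ⟨a, b, p⟩ := mapPath_injective P h.choose_spec
  rw [coeff_proj]
  change dite _ _ _ = _
  rw [dif_pos h, h1]

theorem degreeGE_extend {n : ℕ} {g : CompletedPathAlgebra (KeepVertices P)} (hg : DegreeGE n g) :
    DegreeGE n (extend P g) := by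
  classical
  intro a b p hp
  change dite _ _ _ = _
  split_ifs with h
  · refine hg _ _ _ ?_
    have h1 := congrArg (fun z : Σ a b : V, Quiver.Path a b => z.2.2.length) h.choose_spec
    have h2 : p.length = _ := h1.symm.trans (length_mapPath P _)
    omega
  · rfl

/-- If v and w both remain, then appending e to a remaining path gives a remaining path, where f has
coefficient zero. If v is deleted, no remaining path ends there. -/
theorem proj_cancelArrow {v w : V} (hw : P w) (e : v ⟶ w) {f : CompletedPathAlgebra V}
    (hf : proj P f = 0) : proj P (cancelArrow e f) = 0 := by
  refine ext_coeff fun a b p => ?_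
  rw [coeff_proj, coeff_zero]
  obtain ⟨b, hb⟩ := b
  by_cases h : b = v
  · subst h
    refine (coeff_cancelArrow e f _).trans ?_
    have : (proj P f).1 a ⟨w, hw⟩ (p.cons (show (⟨b, hb⟩ : KeepVertices P) ⟶ ⟨w, hw⟩ from e)) = 0 := by
      rw [hf]; rfl
    exact this
  · exact coeff_cancelArrow_of_ne e f _ h

end KeepVertices

/-! ### Adic completions -/

namespace adicCompletionAt

variable {A : Type*} [Ring A] [Algebra ℂ A] {n m : Ideal A} [n.IsTwoSided] [m.IsTwoSided]

@[simp] theorem coe_add (x y : adicCompletionAt n) (k : ℕ) : (x + y).1 k = x.1 k + y.1 k := rfl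

@[simp] theorem coe_sub (x y : adicCompletionAt n) (k : ℕ) : (x - y).1 k = x.1 k - y.1 k := rfl

@[simp] theorem coe_mul (x y : adicCompletionAt n) (k : ℕ) : (x * y).1 k = x.1 k * y.1 k := rfl

@[simp] theorem coe_zero (k : ℕ) : (0 : adicCompletionAt n).1 k = 0 := rfl

@[simp] theorem coe_smul (c : ℂ) (x : adicCompletionAt n) (k : ℕ) : (c • x).1 k = c • x.1 k := rfl

theorem coe_sum {κ : Type*} (s : Finset κ) (x : κ → adicCompletionAt n) (k : ℕ) :
    (∑ i ∈ s, x i).1 k = ∑ i ∈ s, (x i).1 k := by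
  classical
  induction s using Finset.induction_on with
  | empty => rfl
  | insert i s hi ih => rw [Finset.sum_insert hi, Finset.sum_insert hi, coe_add, ih]

theorem ext_coe {x y : adicCompletionAt n} (h : ∀ k, x.1 k = y.1 k) : x = y := Subtype.ext (funext h)

theorem exists_rep (x : adicCompletionAt n) (k : ℕ) :
    ∃ a : A, ∀ j ≤ k, x.1 j = Ideal.Quotient.mk (n ^ j) a := by
  obtain ⟨a, ha⟩ := Ideal.Quotient.mk_surjective (x.1 k)
  refine ⟨a, fun j hj => ?_⟩
  rw [← x.2 j k hj, ← ha]
  rfl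

theorem coe_eq_zero_of_le {x : adicCompletionAt n} {j k : ℕ} (h : j ≤ k) (hx : x.1 k = 0) : x.1 j = 0 := by
  rw [← x.2 j k h, hx, map_zero]

theorem coe_mul_eq_zero {x y : adicCompletionAt n} {j k : ℕ} (hx : x.1 j = 0) (hy : y.1 k = 0) :
    (x * y).1 (j + k) = 0 := by
  obtain ⟨a, ha⟩ := exists_rep x (j + k)
  obtain ⟨b, hb⟩ := exists_rep y (j + k)
  rw [ha j (by omega), Ideal.Quotient.eq_zero_iff_mem] at hx
  rw [hb k (by omega), Ideal.Quotient.eq_zero_iff_mem] at hy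
  rw [coe_mul, ha _ le_rfl, hb _ le_rfl, ← map_mul, Ideal.Quotient.eq_zero_iff_mem,
    Ideal.IsTwoSided.pow_add]
  exact Ideal.mul_mem_mul hx hy

theorem coe_zero_index (x : adicCompletionAt n) : x.1 0 = 0 := by
  obtain ⟨a, ha⟩ := exists_rep x 0
  rw [ha 0 le_rfl, Ideal.Quotient.eq_zero_iff_mem, Submodule.pow_zero, Ideal.one_eq_top]
  trivial

/-- The canonical map from an algebra to its completion. -/
def of (n : Ideal A) [n.IsTwoSided] (a : A) : adicCompletionAt n :=
  ⟨fun k => Ideal.Quotient.mk (n ^ k) a, fun _ _ _ => rfl⟩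

@[simp] theorem coe_of (a : A) (k : ℕ) : (of n a).1 k = Ideal.Quotient.mk (n ^ k) a := rfl

/-- Completeness: the terms of index at least j vanish at level j, so a partial sum of length j
already determines that level. -/
theorem exists_sum_eq (h : ℕ → adicCompletionAt n) (hh : ∀ j, (h j).1 j = 0) :
    ∃ x : adicCompletionAt n, ∀ j, x.1 j = (∑ i ∈ Finset.range j, h i).1 j := by
  refine ⟨⟨fun j => (∑ i ∈ Finset.range j, h i).1 j, fun i j hij => ?_⟩, fun j => rfl⟩
  rw [(∑ i ∈ Finset.range j, h i).2 i j hij]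
  beta_reduce
  rw [coe_sum, coe_sum, ← Finset.sum_range_add_sum_Ico _ hij, add_eq_left]
  exact Finset.sum_eq_zero fun l hl => coe_eq_zero_of_le (Finset.mem_Ico.1 hl).1 (hh l)

/-- The map of completions for an inclusion of ideals. -/
def map (h : n ≤ m) : adicCompletionAt n →ₐ[ℂ] adicCompletionAt m where
  toFun x := ⟨fun k => Ideal.Quotient.factor (Ideal.pow_right_mono h k) (x.1 k), fun i j hij => by
    obtain ⟨a, ha⟩ := exists_rep x j
    beta_reduce
    rw [ha i hij, ha j le_rfl]
    rfl⟩
  map_one' := ext_coe fun k => map_one _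
  map_mul' x y := ext_coe fun k => map_mul _ _ _
  map_zero' := ext_coe fun k => map_zero _
  map_add' x y := ext_coe fun k => map_add _ _ _
  commutes' c := rfl

theorem coe_map (h : n ≤ m) (x : adicCompletionAt n) (k : ℕ) :
    (map h x).1 k = Ideal.Quotient.factor (Ideal.pow_right_mono h k) (x.1 k) := rfl

theorem coe_map_of_eq (h : n ≤ m) {x : adicCompletionAt n} {k : ℕ} {a : A}
    (ha : x.1 k = Ideal.Quotient.mk (n ^ k) a) : (map h x).1 k = Ideal.Quotient.mk (m ^ k) a := by
  rw [coe_map, ha]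
  rfl

/-- A sequence of representatives of y is chosen whose consecutive differences lie in 𝔫^k and not
merely in 𝔪^k. It is then a compatible sequence for 𝔫. -/
theorem map_surjective (h : n ≤ m) (hm : m ≤ n ⊔ m ^ 2) : Function.Surjective (map h) := by
  intro y
  have hpow := Ideal.pow_le_pow_sup_pow_succ m n h hm
  have hstep : ∀ (k : ℕ) (a : {a : A // y.1 k = Ideal.Quotient.mk (m ^ k) a}),
      ∃ b : {b : A // y.1 (k + 1) = Ideal.Quotient.mk (m ^ (k + 1)) b}, b.1 - a.1 ∈ n ^ k := by
    rintro k ⟨a, ha⟩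
    obtain ⟨b, hb⟩ := exists_rep y (k + 1)
    have hab : b - a ∈ m ^ k := by
      rw [← Ideal.Quotient.eq, ← ha, hb k (Nat.le_succ k)]
    -- The part d of the difference in 𝔪^(k+1) is invisible at level k + 1 and can be subtracted
    -- from b.
    obtain ⟨c, hc, d, hd, hcd⟩ := Submodule.mem_sup.1 (hpow k hab)
    refine ⟨⟨b - d, ?_⟩, ?_⟩
    · rw [hb _ le_rfl, Ideal.Quotient.eq]
      simpa using hd
    · have : b - d - a = c := by rw [sub_right_comm, ← hcd, add_sub_cancel_right]
      exact this ▸ hc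
  choose b hb using hstep
  obtain ⟨a₀, ha₀⟩ := exists_rep y 0
  let a : ∀ k, {a : A // y.1 k = Ideal.Quotient.mk (m ^ k) a} :=
    fun k => Nat.rec ⟨a₀, ha₀ 0 le_rfl⟩ (fun k x => b k x) k
  have ha : ∀ k, (a (k + 1)).1 - (a k).1 ∈ n ^ k := fun k => hb k (a k)
  refine ⟨⟨fun k => Ideal.Quotient.mk (n ^ k) (a k).1, fun i j hij => ?_⟩, ext_coe fun k => ?_⟩
  · change Ideal.Quotient.mk (n ^ i) (a j).1 = _
    rw [Ideal.Quotient.eq]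
    induction j, hij using Nat.le_induction with
    | base => rw [sub_self]; exact zero_mem _
    | succ j hij ih =>
      rw [← sub_add_sub_cancel _ (a j).1]
      exact add_mem (Ideal.pow_le_pow_right hij (ha j)) ih
  · rw [(a k).2]
    rfl

end adicCompletionAt

/-! ### Presentations of corners of a completion -/

/-- `θ` identifies `ℂQ̂/I` with `e Â e`, where `Â` is the completion at the annihilator of `M` and
`e = θ 1`, and it sends the vertices to idempotents that are minimal modulo the radical. -/
structure IsCornerPresentation (A : Type*) [Ring A] [Algebra ℂ A] (M : Type*) [AddCommGroup M]
    [Module A M] {V : Type*} [Finite V] [Quiver V] (S : V → Type*) [∀ v, AddCommGroup (S v)]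
    [∀ v, Module ℂ (S v)] [∀ v, Module A (S v)] [∀ v, IsScalarTower ℂ A (S v)]
    (I : Ideal (CompletedPathAlgebra V))
    (θ : CompletedPathAlgebra V →ₙₐ[ℂ] adicCompletionAt (Module.annihilator A M)) : Prop where
  eq_zero_iff : ∀ f, θ f = 0 ↔ f ∈ I
  exists_eq : ∀ x, θ 1 * x * θ 1 = x → ∃ f, θ f = x
  finrank_self : ∀ (v : V) (a : A), Ideal.Quotient.mk (Module.annihilator A M ^ 1) a =
    (θ (vertexIdempotent v)).1 1 → Module.finrank ℂ (LinearMap.range (Algebra.lsmul ℂ ℂ (S v) a)) = 1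
  finrank_of_ne : ∀ (v w : V) (a : A), v ≠ w → Ideal.Quotient.mk (Module.annihilator A M ^ 1) a =
    (θ (vertexIdempotent v)).1 1 → Module.finrank ℂ (LinearMap.range (Algebra.lsmul ℂ ℂ (S w) a)) = 0

section

variable {A : Type*} [Ring A] [Algebra ℂ A] {M : Type*} [AddCommGroup M]
    [Module A M] {V : Type*} [Finite V] [Quiver V] {S : V → Type*} [∀ v, AddCommGroup (S v)]
    [∀ v, Module ℂ (S v)] [∀ v, Module A (S v)] [∀ v, IsScalarTower ℂ A (S v)]
    {I : Ideal (CompletedPathAlgebra V)} [I.IsTwoSided]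

/-- Forgetting the corner ring in favour of a non-unital map to the whole completion makes it
possible to compose with maps between completions. -/
theorem IsLocalModel.exists_isCornerPresentation (h : IsLocalModel A M S I) :
    ∃ θ, IsCornerPresentation A M S I θ := by
  obtain ⟨e, he, Ψ, ε, hsmul, hε, hrank⟩ := h.basic
  refine ⟨{ toFun := fun f => (Ψ (Ideal.Quotient.mk I f)).1
            map_smul' := fun c f => hsmul c (Ideal.Quotient.mk I f)
            map_zero' := congrArg Subtype.val (map_zero Ψ)
            map_add' := fun f g => congrArg Subtype.val
              (Ψ.map_add' (Ideal.Quotient.mk I f) (Ideal.Quotient.mk I g))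
            map_mul' := fun f g => congrArg Subtype.val
              (Ψ.map_mul' (Ideal.Quotient.mk I f) (Ideal.Quotient.mk I g)) }, ?_, ?_, ?_, ?_⟩
  · intro f
    change (Ψ (Ideal.Quotient.mk I f)).1 = 0 ↔ _
    rw [← Ideal.Quotient.eq_zero_iff_mem, ← map_eq_zero_iff Ψ Ψ.injective]
    exact ⟨fun h => Subtype.ext h, fun h => congrArg Subtype.val h⟩
  · intro x hx
    change (Ψ (Ideal.Quotient.mk I 1)).1 * x * (Ψ (Ideal.Quotient.mk I 1)).1 = x at hx
    rw [map_one, map_one] at hx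
    obtain ⟨f, hf⟩ := Ideal.Quotient.mk_surjective (Ψ.symm ⟨x, ⟨x, hx⟩⟩)
    refine ⟨f, ?_⟩
    change (Ψ (Ideal.Quotient.mk I f)).1 = x
    rw [hf]
    exact congrArg Subtype.val (Ψ.apply_symm_apply _)
  · intro v a ha
    have := hrank v v a (ha.trans (congrArg (fun z => z.1 1) (hε v)))
    rwa [if_pos rfl] at this
  · intro v w a hvw ha
    have := hrank v w a (ha.trans (congrArg (fun z => z.1 1) (hε v)))
    rwa [if_neg hvw] at this

theorem IsCornerPresentation.isLocalModel
    {θ : CompletedPathAlgebra V →ₙₐ[ℂ] adicCompletionAt (Module.annihilator A M)}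
    (h : IsCornerPresentation A M S I θ) (hS : IsListOfFactors A M S) (hI : IsClosedIdeal I)
    (hI2 : ∀ f ∈ I, DegreeGE 2 f) : IsLocalModel A M S I := by
  refine ⟨hS, hI, hI2, ?_⟩
  have he : IsIdempotentElem (θ 1) := by rw [IsIdempotentElem, ← map_mul, mul_one]
  let F : CompletedPathAlgebra V →+* he.Corner :=
    { toFun := fun f => ⟨θ f, ⟨θ f, by change θ 1 * θ f * θ 1 = θ f; rw [← map_mul, ← map_mul, one_mul, mul_one]⟩⟩
      map_one' := rfl
      map_mul' := fun f g => Subtype.ext (map_mul θ f g)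
      map_zero' := Subtype.ext (map_zero θ)
      map_add' := fun f g => Subtype.ext (map_add θ f g) }
  have hF : ∀ f, F f = 0 ↔ f ∈ I := fun f => by
    rw [← h.eq_zero_iff]
    exact ⟨fun h => congrArg Subtype.val h, fun h => Subtype.ext h⟩
  let G := Ideal.Quotient.lift I F fun f hf => (hF f).2 hf
  have hG : Function.Bijective G := by
    constructor
    · intro x y hxy
      obtain ⟨f, rfl⟩ := Ideal.Quotient.mk_surjective x
      obtain ⟨g, rfl⟩ := Ideal.Quotient.mk_surjective y
      have hfg : θ f = θ g := congrArg Subtype.val hxy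
      rw [Ideal.Quotient.eq, ← h.eq_zero_iff, map_sub, hfg, sub_self]
    · rintro ⟨x, y, hy⟩
      obtain ⟨f, hf⟩ := h.exists_eq x (by
        subst hy
        change θ 1 * (θ 1 * y * θ 1) * θ 1 = θ 1 * y * θ 1
        simp only [← mul_assoc, he.eq]
        rw [mul_assoc _ (θ 1) (θ 1), he.eq])
      exact ⟨Ideal.Quotient.mk I f, Subtype.ext hf⟩
  refine ⟨θ 1, he, RingEquiv.ofBijective G hG, fun v => θ (vertexIdempotent v), ?_, ?_, ?_⟩
  · intro c x
    obtain ⟨f, rfl⟩ := Ideal.Quotient.mk_surjective x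
    exact map_smul θ c f
  · intro v
    rfl
  · intro v w a ha
    split_ifs with hvw
    · subst hvw
      exact h.finrank_self v a ha
    · exact h.finrank_of_ne v w a hvw ha

end

/-! ### The action on the simple factors -/

namespace IsListOfFactors

variable {A : Type*} [Ring A] [Algebra ℂ A] {M : Type*} [AddCommGroup M] [Module A M] {V : Type*}
  {S : V → Type*} [∀ v, AddCommGroup (S v)] [∀ v, Module ℂ (S v)] [∀ v, Module A (S v)]
  [∀ v, IsScalarTower ℂ A (S v)]

theorem smul_eq_zero_of_mem_annihilator (hS : IsListOfFactors A M S) (w : V) {a : A}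
    (ha : a ∈ Module.annihilator A M) (x : S w) : a • x = 0 := by
  obtain ⟨f, hf⟩ := hS.occurs w
  apply hf
  rw [map_smul, Module.mem_annihilator.1 ha, map_zero]

/-- The action of `A` modulo the annihilator of `M` on a simple factor of `M`. -/
def action (hS : IsListOfFactors A M S) (w : V) :
    A ⧸ Module.annihilator A M ^ 1 →ₐ[ℂ] Module.End ℂ (S w) :=
  Ideal.Quotient.liftₐ _ (Algebra.lsmul ℂ ℂ (S w)) fun a ha => by
    rw [Submodule.pow_one] at ha
    ext x
    exact hS.smul_eq_zero_of_mem_annihilator w ha x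

@[simp] theorem action_mk (hS : IsListOfFactors A M S) (w : V) (a : A) :
    hS.action w (Ideal.Quotient.mk _ a) = Algebra.lsmul ℂ ℂ (S w) a := rfl

/-- M is the sum of its simple submodules, each isomorphic to some `S v`, so A modulo the
annihilator acts faithfully on the listed factors taken together. -/
theorem eq_zero_of_action [IsSemisimpleModule A M] (hS : IsListOfFactors A M S)
    {z : A ⧸ Module.annihilator A M ^ 1} (hz : ∀ w, hS.action w z = 0) : z = 0 := by
  obtain ⟨a, rfl⟩ := Ideal.Quotient.mk_surjective z
  rw [Ideal.Quotient.eq_zero_iff_mem, Submodule.pow_one, Module.mem_annihilator]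
  intro y
  have hy : y ∈ sSup {m : Submodule A M | IsSimpleModule A m} :=
    IsSemisimpleModule.sSup_simples_eq_top A M ▸ Submodule.mem_top
  rw [sSup_eq_iSup'] at hy
  induction hy using Submodule.iSup_induction' with
  | zero => simp
  | add x y _ _ hx hy => rw [smul_add, hx, hy, add_zero]
  | mem T x hx =>
    obtain ⟨v, ⟨E⟩⟩ := hS.complete T.1 T.2
    have h1 : a • (⟨x, hx⟩ : T.1) = 0 := by
      apply E.injective
      rw [map_smul, map_zero]
      exact LinearMap.congr_fun (hz v) (E ⟨x, hx⟩)
    exact congrArg Subtype.val h1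

theorem finiteDimensional [Module ℂ M] [IsScalarTower ℂ A M] [FiniteDimensional ℂ M]
    (hS : IsListOfFactors A M S) (w : V) : FiniteDimensional ℂ (S w) := by
  obtain ⟨f, hf⟩ := hS.occurs w
  exact Module.Finite.of_injective (f.restrictScalars ℂ) hf

end IsListOfFactors

/-- The left ideal generated by the right ideals `a v A` for the indices `v` with `Z v`. -/
def vertexIdeal {A : Type*} [Ring A] {V : Type*} (a : V → A) (Z : V → Prop) : Ideal A :=
  Ideal.span {x | ∃ v q, Z v ∧ x = a v * q}

instance {A : Type*} [Ring A] {V : Type*} (a : V → A) (Z : V → Prop) : (vertexIdeal a Z).IsTwoSided :=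
  ⟨fun b hx => by
    induction hx using Submodule.span_induction with
    | mem x hx =>
      obtain ⟨v, q, hv, rfl⟩ := hx
      exact Ideal.subset_span ⟨v, q * b, hv, mul_assoc _ _ _⟩
    | zero => rw [zero_mul]; exact zero_mem _
    | add x y _ _ hx hy => rw [add_mul]; exact add_mem hx hy
    | smul c x _ hx => rw [smul_eq_mul, mul_assoc]; exact Ideal.mul_mem_left _ _ hx⟩

namespace IsCornerPresentation

open adicCompletionAt CompletedPathAlgebra

variable {A : Type*} [Ring A] [Algebra ℂ A] {N : Type*} [AddCommGroup N] [Module A N]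
  {V : Type*} [Finite V] [Quiver V] {S : V → Type*} [∀ v, AddCommGroup (S v)]
  [∀ v, Module ℂ (S v)] [∀ v, Module A (S v)] [∀ v, IsScalarTower ℂ A (S v)]
  {I : Ideal (CompletedPathAlgebra V)}
  {θ : CompletedPathAlgebra V →ₙₐ[ℂ] adicCompletionAt (Module.annihilator A N)}

theorem exists_eq_mul_mul (hθ : IsCornerPresentation A N S I θ)
    (x : adicCompletionAt (Module.annihilator A N)) : ∃ f, θ f = θ 1 * x * θ 1 := by
  have he : θ 1 * θ 1 = θ 1 := by rw [← map_mul, mul_one]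
  refine hθ.exists_eq _ ?_
  simp only [← mul_assoc, he]
  rw [mul_assoc _ (θ 1) (θ 1), he]

theorem one_mul_mul_one (f : CompletedPathAlgebra V) : θ 1 * θ f * θ 1 = θ f := by
  rw [← map_mul, ← map_mul, one_mul, mul_one]

theorem mem_of_forall_coe_eq_zero (hθ : IsCornerPresentation A N S I θ) {f : CompletedPathAlgebra V}
    (h : ∀ k, (θ f).1 k = 0) : f ∈ I :=
  (hθ.eq_zero_iff f).1 (ext_coe h)

theorem coe_mul_eq_zero_of {f g : CompletedPathAlgebra V} {j k : ℕ} (hf : (θ f).1 j = 0)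
    (hg : (θ g).1 k = 0) : (θ (f * g)).1 (j + k) = 0 := by
  rw [map_mul]
  exact coe_mul_eq_zero hf hg

theorem coe_sum_eq_zero {κ : Type*} (s : Finset κ) (f : κ → CompletedPathAlgebra V) {k : ℕ}
    (h : ∀ i ∈ s, (θ (f i)).1 k = 0) : (θ (∑ i ∈ s, f i)).1 k = 0 := by
  rw [map_sum, coe_sum]
  exact Finset.sum_eq_zero h

/-- Convergence in the completion carries over to ℂQ̂: the limit is cut down by θ(1) on both sides,
which does not change the partial sums, and then lifted. -/
theorem exists_sum_sub (hθ : IsCornerPresentation A N S I θ) (h : ℕ → CompletedPathAlgebra V)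
    (hh : ∀ j, (θ (h j)).1 j = 0) :
    ∃ g, ∀ j, (θ (g - ∑ i ∈ Finset.range j, h i)).1 j = 0 := by
  obtain ⟨x, hx⟩ := exists_sum_eq (fun j => θ (h j)) hh
  obtain ⟨g, hg⟩ := hθ.exists_eq_mul_mul x
  refine ⟨g, fun j => ?_⟩
  rw [map_sub, coe_sub, hg, coe_mul, coe_mul, hx j, ← coe_mul, ← coe_mul, ← map_sum, one_mul_mul_one,
    sub_self]

/-- The action of the completed path algebra on a simple factor of the module. -/
def vertexAction (hS : IsListOfFactors A N S)
    (θ : CompletedPathAlgebra V →ₙₐ[ℂ] adicCompletionAt (Module.annihilator A N)) (w : V) :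
    CompletedPathAlgebra V →ₙₐ[ℂ] Module.End ℂ (S w) where
  toFun f := hS.action w ((θ f).1 1)
  map_smul' c f := by
    rw [map_smul, coe_smul, map_smul]
    rfl
  map_zero' := by rw [map_zero, coe_zero, map_zero]
  map_add' f g := by rw [map_add, coe_add, map_add]
  map_mul' f g := by rw [map_mul, coe_mul, map_mul]

theorem vertexAction_apply (hS : IsListOfFactors A N S) (w : V) (f : CompletedPathAlgebra V) :
    vertexAction hS θ w f = hS.action w ((θ f).1 1) := rfl

theorem finrank_range_vertexAction (hθ : IsCornerPresentation A N S I θ) (hS : IsListOfFactors A N S)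
    (v : V) :
    Module.finrank ℂ (LinearMap.range (vertexAction hS θ v (vertexIdempotent v))) = 1 := by
  obtain ⟨a, ha⟩ := Ideal.Quotient.mk_surjective ((θ (vertexIdempotent v)).1 1)
  rw [vertexAction_apply, ← ha]
  exact hθ.finrank_self v a ha

section

variable [Module ℂ N] [IsScalarTower ℂ A N] [FiniteDimensional ℂ N]

theorem vertexAction_of_ne (hθ : IsCornerPresentation A N S I θ) (hS : IsListOfFactors A N S)
    {v w : V} (h : v ≠ w) : vertexAction hS θ w (vertexIdempotent v) = 0 := by
  obtain ⟨a, ha⟩ := Ideal.Quotient.mk_surjective ((θ (vertexIdempotent v)).1 1)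
  have h1 := hθ.finrank_of_ne v w a h ha
  have := hS.finiteDimensional w
  rw [vertexAction_apply, ← ha]
  exact LinearMap.range_eq_bot.1 (Submodule.finrank_eq_zero.1 h1)

theorem vertexAction_one (hθ : IsCornerPresentation A N S I θ) (hS : IsListOfFactors A N S) (w : V) :
    vertexAction hS θ w 1 = vertexAction hS θ w (vertexIdempotent w) := by
  have := Fintype.ofFinite V
  rw [← sum_vertexIdempotent, map_sum]
  exact Finset.sum_eq_single_of_mem w (Finset.mem_univ w) fun v _ hv => hθ.vertexAction_of_ne hS hv

/-- The identity of ℂQ̂ acts on `S w` as a projection onto a line, so f acts on that line by a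
scalar c. If c ≠ 0, the element 1 - c⁻¹f is left invertible by the geometric series, yet it kills
the line. -/
theorem vertexAction_eq_zero (hθ : IsCornerPresentation A N S I θ) (hS : IsListOfFactors A N S) (w : V)
    {f : CompletedPathAlgebra V} (hf : DegreeGE 1 f) : vertexAction hS θ w f = 0 := by
  set R := vertexAction hS θ w
  have hfr : Module.finrank ℂ (LinearMap.range (R 1)) = 1 := by
    rw [hθ.vertexAction_one hS w]
    exact hθ.finrank_range_vertexAction hS w
  obtain ⟨t, ht0, ht⟩ := finrank_eq_one_iff'.1 hfr
  have hR1 : R 1 * R 1 = R 1 := by rw [← map_mul, mul_one]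
  have hRt : R 1 t.1 = t.1 := by
    obtain ⟨x, hx⟩ := t.2
    rw [← hx, ← Module.End.mul_apply, hR1]
  have hft : R f t.1 = 0 := by
    obtain ⟨c, hc⟩ := ht ⟨R f t.1, ⟨R f t.1, by rw [← Module.End.mul_apply, ← map_mul, one_mul]⟩⟩
    have hc' : c • t.1 = R f t.1 := congrArg Subtype.val hc
    by_contra hne
    have hc0 : c ≠ 0 := by
      rintro rfl
      exact hne (by rw [← hc', zero_smul])
    obtain ⟨g, hg⟩ := (hf.smul c⁻¹).exists_mul_one_sub_eq_one
    have key : R (g * (1 - c⁻¹ • f)) t.1 = 0 := by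
      rw [map_mul, Module.End.mul_apply, map_sub, map_smul, LinearMap.sub_apply, hRt,
        LinearMap.smul_apply, ← hc', smul_smul, inv_mul_cancel₀ hc0, one_smul, sub_self, map_zero]
    rw [hg, hRt] at key
    exact ht0 (Subtype.ext key)
  ext x
  obtain ⟨c, hc⟩ := ht ⟨R 1 x, ⟨x, rfl⟩⟩
  have hc' : c • t.1 = R 1 x := congrArg Subtype.val hc
  rw [← mul_one f, map_mul, Module.End.mul_apply, ← hc', map_smul, hft, smul_zero]
  rfl

/-- The elements of degree at least one are the ones that map into the radical of the completion. -/
theorem coe_one_eq_zero_iff [IsSemisimpleModule A N] (hθ : IsCornerPresentation A N S I θ)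
    (hS : IsListOfFactors A N S) {f : CompletedPathAlgebra V} : (θ f).1 1 = 0 ↔ DegreeGE 1 f := by
  refine ⟨fun h => DegreeGE.one_iff.2 fun w => ?_, fun h => hS.eq_zero_of_action fun w =>
    hθ.vertexAction_eq_zero hS w h⟩
  have := Fintype.ofFinite V
  have h1 := hθ.vertexAction_eq_zero hS w (DegreeGE.sub_sum_vertexIdempotent f)
  have h2 : vertexAction hS θ w f = 0 := by rw [vertexAction_apply, h, map_zero]
  -- On `S w` only the constant coefficient at w survives, multiplied by an operator of rank one.
  rw [map_sub, h2, zero_sub, neg_eq_zero, map_sum, Finset.sum_eq_single_of_mem w (Finset.mem_univ w)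
    fun v _ hv => by rw [map_smul, hθ.vertexAction_of_ne hS hv, smul_zero], map_smul, smul_eq_zero] at h1
  refine h1.resolve_right fun h0 => ?_
  have := hθ.finrank_range_vertexAction hS w
  rw [h0, LinearMap.range_zero, finrank_bot] at this
  exact zero_ne_one this

/-- A simple submodule of N not occurring in M is some `S v` with `Z v`, and there `a v` acts with
rank one, hence not as zero. With M = 0 and all vertices this says that e is a full idempotent
modulo 𝔫; with the deleted vertices it describes 𝔪 modulo 𝔫. -/
theorem annihilator_le_vertexIdeal_sup [IsSemisimpleModule A N] (hθ : IsCornerPresentation A N S I θ)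
    (hS : IsListOfFactors A N S) {M : Type*} [AddCommGroup M] [Module A M] (Z : V → Prop)
    (hZ : ∀ v, ¬ Z v → OccursIn A (S v) M) (a : V → A)
    (ha : ∀ v, Ideal.Quotient.mk (Module.annihilator A N ^ 1) (a v) = (θ (vertexIdempotent v)).1 1) :
    Module.annihilator A M ≤ vertexIdeal a Z ⊔ Module.annihilator A N := by
  have := Ideal.isTwoSided_sup (vertexIdeal a Z) (Module.annihilator A N)
  refine annihilator_le_of_smul_ne_zero _ le_sup_right fun T hT hTM => ?_
  obtain ⟨v, ⟨E⟩⟩ := hS.complete T hT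
  have hv : Z v := by
    by_contra h
    obtain ⟨f, hf⟩ := hZ v h
    exact hTM ⟨f.comp E.toLinearMap, hf.comp E.injective⟩
  refine ⟨a v, Ideal.mem_sup_left (Ideal.subset_span ⟨v, 1, hv, (mul_one _).symm⟩), ?_⟩
  by_contra! h
  have h0 : Algebra.lsmul ℂ ℂ (S v) (a v) = 0 := by
    ext x
    have := congrArg E (h (E.symm x))
    rwa [map_smul, E.apply_symm_apply, map_zero] at this
  have h1 := hθ.finrank_self v (a v) (ha v)
  rw [h0, LinearMap.range_zero, finrank_bot] at h1
  exact zero_ne_one h1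

end

end IsCornerPresentation

/-! ### Comparison of the degree filtration with the adic filtration -/

namespace IsCornerPresentation

open adicCompletionAt CompletedPathAlgebra

variable {A : Type*} [Ring A] [Algebra ℂ A] {N : Type*} [AddCommGroup N] [Module A N]
  {V : Type*} [Finite V] [Quiver V] {S : V → Type*} [∀ v, AddCommGroup (S v)]
  [∀ v, Module ℂ (S v)] [∀ v, Module A (S v)] [∀ v, IsScalarTower ℂ A (S v)]
  {I : Ideal (CompletedPathAlgebra V)}
  {θ : CompletedPathAlgebra V →ₙₐ[ℂ] adicCompletionAt (Module.annihilator A N)}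

/-- Elements that are generated modulo the `j`-th step of the adic filtration by the family `X`
with coefficients in the `k`-th step. -/
def GeneratedAt (θ : CompletedPathAlgebra V →ₙₐ[ℂ] adicCompletionAt (Module.annihilator A N))
    {r : ℕ} (X : Fin r → CompletedPathAlgebra V) (k j : ℕ)
    (x : adicCompletionAt (Module.annihilator A N)) : Prop :=
  ∃ g : Fin r → CompletedPathAlgebra V, (∀ i, (θ (g i)).1 k = 0) ∧ (x - θ (∑ i, g i * X i)).1 j = 0

namespace GeneratedAt

variable {r : ℕ} {X : Fin r → CompletedPathAlgebra V} {k j : ℕ}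
  {x y : adicCompletionAt (Module.annihilator A N)}

theorem of_coe_eq_zero (h : x.1 j = 0) : GeneratedAt θ X k j x :=
  ⟨0, fun i => by rw [Pi.zero_apply, map_zero]; rfl, by simpa using h⟩

theorem add (hx : GeneratedAt θ X k j x) (hy : GeneratedAt θ X k j y) : GeneratedAt θ X k j (x + y) := by
  obtain ⟨g, hg, hx⟩ := hx
  obtain ⟨g', hg', hy⟩ := hy
  refine ⟨g + g', fun i => ?_, ?_⟩
  · rw [Pi.add_apply, map_add, coe_add, hg, hg', add_zero]
  · have : x + y - θ (∑ i, (g + g') i * X i) =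
        (x - θ (∑ i, g i * X i)) + (y - θ (∑ i, g' i * X i)) := by
      simp only [Pi.add_apply, add_mul, Finset.sum_add_distrib, map_add]
      abel
    rw [this, coe_add, hx, hy, add_zero]

theorem congr (hx : GeneratedAt θ X k j x) (h : (y - x).1 j = 0) : GeneratedAt θ X k j y := by
  simpa using hx.add (of_coe_eq_zero (X := X) (k := k) (θ := θ) h)

end GeneratedAt

section

variable [Module ℂ N] [IsScalarTower ℂ A N] [FiniteDimensional ℂ N] [IsSemisimpleModule A N]

/-- Fullness of e gives 1 ≡ Σ p·a_v·q modulo 𝔫. Inserting this between c ∈ 𝔫^k and d ∈ 𝔫 splits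
e(cd)e into products of two elements of the corner; the right factor has order one and is a
combination of the X_i modulo order two. -/
theorem generatedAt_mul (hθ : IsCornerPresentation A N S I θ) (hS : IsListOfFactors A N S) {r : ℕ}
    (X : Fin r → CompletedPathAlgebra V)
    (hX : ∀ f, (θ f).1 1 = 0 → ∃ c : Fin r → ℂ, (θ (f - ∑ i, c i • X i)).1 2 = 0) {k : ℕ} {b : A}
    (hb : b ∈ Module.annihilator A N ^ k * Module.annihilator A N) :
    GeneratedAt θ X k (k + 2) (θ 1 * of _ b * θ 1) := by
  choose a ha using fun v => Ideal.Quotient.mk_surjective ((θ (vertexIdempotent v)).1 1)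
  have hsup : (1 : A) ∈ vertexIdeal a (fun _ => True) ⊔ Module.annihilator A N := by
    -- The zero module has annihilator A, and no vertex has to occur in it.
    refine hθ.annihilator_le_vertexIdeal_sup hS (M := PUnit.{1}) (fun _ => True) (fun v h => absurd trivial h)
      a ha ?_
    exact Module.mem_annihilator.2 fun _ => rfl
  obtain ⟨y, hy, ν, hν, hyν⟩ := Submodule.mem_sup.1 hsup
  have of_add : ∀ x y : A, of (Module.annihilator A N) (x + y) = of _ x + of _ y := fun x y => rfl
  have of_mul : ∀ x y : A, of (Module.annihilator A N) (x * y) = of _ x * of _ y := fun x y => rfl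
  have of_zero : ∀ (j : ℕ) (x : A), x ∈ Module.annihilator A N ^ j →
      (of (Module.annihilator A N) x).1 j = 0 := fun j x h => Ideal.Quotient.eq_zero_iff_mem.2 h
  have sandwich : ∀ (x : adicCompletionAt (Module.annihilator A N)) (j : ℕ), x.1 j = 0 →
      (θ 1 * x * θ 1).1 j = 0 := fun x j h => by
    rw [coe_mul, coe_mul, h, mul_zero, zero_mul]
  refine Submodule.smul_induction_on (p := fun b => GeneratedAt θ X k (k + 2) (θ 1 * of _ b * θ 1)) hb ?_ ?_
  swap
  · intro b b' hb hb'
    rw [of_add, mul_add, add_mul]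
    exact hb.add hb'
  intro c hc d hd
  -- Quantifying over c lets the span induction absorb a left multiplier of y into c, since 𝔫^k is
  -- two-sided.
  have key : ∀ c ∈ Module.annihilator A N ^ k, GeneratedAt θ X k (k + 2) (θ 1 * of _ (c * y * d) * θ 1) := by
    clear hyν
    induction hy using Submodule.span_induction with
    | zero =>
      intro c _
      rw [mul_zero, zero_mul]
      exact GeneratedAt.of_coe_eq_zero (sandwich _ _ (of_zero _ _ (zero_mem _)))
    | add y y' _ _ h h' =>
      intro c hc
      rw [mul_add, add_mul, of_add, mul_add, add_mul]
      exact (h c hc).add (h' c hc)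
    | smul p y _ h =>
      intro c hc
      rw [smul_eq_mul, ← mul_assoc]
      exact h _ (Ideal.mul_mem_right _ _ hc)
    | mem y hy =>
      obtain ⟨v, q, -, rfl⟩ := hy
      intro c hc
      obtain ⟨F, hF⟩ := hθ.exists_eq_mul_mul (of _ c)
      obtain ⟨G, hG⟩ := hθ.exists_eq_mul_mul (of _ (q * d))
      have hqd : (of (Module.annihilator A N) (q * d)).1 1 = 0 := of_zero _ _ (by
        rw [Submodule.pow_one]; exact Ideal.mul_mem_left _ _ hd)
      have hF0 : (θ F).1 k = 0 := by rw [hF]; exact sandwich _ _ (of_zero _ _ hc)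
      have hG0 : (θ G).1 1 = 0 := by rw [hG]; exact sandwich _ _ hqd
      obtain ⟨s, hs⟩ := hX G hG0
      refine ⟨fun i => s i • (F * vertexIdempotent v), fun i => ?_, ?_⟩
      · rw [map_smul, coe_smul, map_mul, coe_mul, hF0, zero_mul, smul_zero]
      -- Two errors, both of order k + 2: in the first, a_v agrees with ε_v modulo 𝔫 and d adds
      -- another order; in the second, G is replaced by a combination of the X_i modulo order two.
      · have h1 : θ 1 * of _ (c * (a v * q) * d) * θ 1 - θ (∑ i, s i • (F * vertexIdempotent v) * X i) =
            θ 1 * (of _ c * ((of _ (a v) - θ (vertexIdempotent v)) * of _ (q * d))) * θ 1 +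
            θ (F * (vertexIdempotent v * (G - ∑ i, s i • X i))) := by
          have h2 : ∑ i, s i • (F * vertexIdempotent v) * X i =
              F * (vertexIdempotent v * ∑ i, s i • X i) := by
            simp only [Finset.mul_sum, mul_smul_comm, smul_mul_assoc, mul_assoc]
          have h3 : θ (F * (vertexIdempotent v * G)) =
              θ 1 * (of _ c * (θ (vertexIdempotent v) * of _ (q * d))) * θ 1 := by
            have h4 : θ 1 * θ (vertexIdempotent v) * θ 1 = θ (vertexIdempotent v) := one_mul_mul_one _
            have he : θ 1 * θ 1 = θ 1 := by rw [← map_mul, mul_one]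
            calc θ (F * (vertexIdempotent v * G))
                = θ 1 * of _ c * (θ 1 * θ (vertexIdempotent v) * (θ 1 * of _ (q * d))) * θ 1 := by
                  rw [map_mul, map_mul, hF, hG]
                  simp only [mul_assoc]
              _ = θ 1 * of _ c * (θ 1 * θ (vertexIdempotent v) * θ 1 * of _ (q * d)) * θ 1 := by
                  simp only [mul_assoc]
              _ = _ := by
                  rw [h4]
                  simp only [mul_assoc]
          rw [h2, mul_sub, mul_sub, map_sub, h3]
          simp only [of_mul, mul_sub, sub_mul, mul_assoc]
          abel
        rw [h1, coe_add, sandwich _ (k + 2), coe_mul_eq_zero_of hF0, add_zero]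
        · rw [map_mul, coe_mul, hs, mul_zero]
        · refine coe_mul_eq_zero (of_zero _ _ hc) (coe_mul_eq_zero (j := 1) (k := 1) ?_ hqd)
          rw [coe_sub, coe_of, ha, sub_self]
  have hcd : c • d = c * y * d + c * ν * d := by
    rw [← add_mul, ← mul_add, hyν, mul_one, smul_eq_mul]
  rw [hcd, of_add, mul_add, add_mul]
  refine (key c hc).add (GeneratedAt.of_coe_eq_zero (sandwich _ _ (of_zero _ _ ?_)))
  rw [Submodule.pow_succ, Submodule.pow_succ]
  exact Ideal.mul_mem_mul (Ideal.mul_mem_mul hc hν) hd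

/-- The X_i lift a finite spanning family of the image in A/𝔫² of the elements of order one. This is
where A/𝔫² has to be finite dimensional. -/
theorem exists_generatedAt [Algebra.FiniteType ℂ A] (hθ : IsCornerPresentation A N S I θ)
    (hS : IsListOfFactors A N S) :
    ∃ (r : ℕ) (X : Fin r → CompletedPathAlgebra V), (∀ i, (θ (X i)).1 1 = 0) ∧
      ∀ (k : ℕ) (f : CompletedPathAlgebra V), (θ f).1 (k + 1) = 0 → GeneratedAt θ X k (k + 2) (θ f) := by
  have := finiteDimensional_quotient_sq (Module.annihilator A N)
  let L : Submodule ℂ (CompletedPathAlgebra V) :=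
    { carrier := {f | (θ f).1 1 = 0}
      add_mem' := fun {f g} (hf : (θ f).1 1 = 0) (hg : (θ g).1 1 = 0) => by
        change (θ (f + g)).1 1 = 0
        rw [map_add, coe_add, hf, hg, add_zero]
      zero_mem' := by
        change (θ 0).1 1 = 0
        rw [map_zero, coe_zero]
      smul_mem' := fun c f (hf : (θ f).1 1 = 0) => by
        change (θ (c • f)).1 1 = 0
        rw [map_smul, coe_smul, hf, smul_zero] }
  let q : CompletedPathAlgebra V →ₗ[ℂ] A ⧸ Module.annihilator A N ^ 2 :=
    { toFun := fun f => (θ f).1 2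
      map_add' := fun f g => by rw [map_add, coe_add]
      map_smul' := fun c f => by rw [map_smul, coe_smul]; rfl }
  obtain ⟨r, s, hs⟩ := Submodule.fg_iff_exists_fin_generating_family.1
    (IsNoetherian.noetherian (L.map q))
  have hsL : ∀ i, ∃ f ∈ L, q f = s i := fun i => by
    have : s i ∈ L.map q := hs ▸ Submodule.subset_span ⟨i, rfl⟩
    exact this
  choose X hXL hXs using hsL
  refine ⟨r, X, hXL, fun k f hf => ?_⟩
  obtain ⟨b, hb⟩ := exists_rep (θ f) (k + 2)
  rw [hb (k + 1) (Nat.le_succ _), Ideal.Quotient.eq_zero_iff_mem, Submodule.pow_succ] at hf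
  refine (hθ.generatedAt_mul hS X (fun g hg => ?_) hf).congr ?_
  · have hg' : q g ∈ Submodule.span ℂ (Set.range s) := hs ▸ ⟨g, hg, rfl⟩
    obtain ⟨c, hc⟩ := (Submodule.mem_span_range_iff_exists_fun ℂ).1 hg'
    refine ⟨c, ?_⟩
    change q (g - ∑ i, c i • X i) = 0
    rw [map_sub, map_sum, ← hc, sub_eq_zero]
    exact Finset.sum_congr rfl fun i _ => by rw [map_smul, hXs]
  · have h1 : θ f - θ 1 * of _ b * θ 1 = θ 1 * (θ f - of _ b) * θ 1 := by
      rw [mul_sub, sub_mul, one_mul_mul_one]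
    rw [h1, coe_mul, coe_mul, coe_sub, hb _ le_rfl, coe_of, sub_self, mul_zero, zero_mul]

/-- The approximate statement is applied to the successive remainders. The corrections to the
coefficients have order k + j and so add up to limits; what remains then vanishes at every level,
that is, lies in ker θ = I. -/
theorem exists_generators [Algebra.FiniteType ℂ A] (hθ : IsCornerPresentation A N S I θ)
    (hS : IsListOfFactors A N S) :
    ∃ (r : ℕ) (X : Fin r → CompletedPathAlgebra V), (∀ i, (θ (X i)).1 1 = 0) ∧
      ∀ (k : ℕ) (f : CompletedPathAlgebra V), (θ f).1 (k + 1) = 0 →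
        ∃ g : Fin r → CompletedPathAlgebra V, (∀ i, (θ (g i)).1 k = 0) ∧ f - ∑ i, g i * X i ∈ I := by
  obtain ⟨r, X, hX, hgen⟩ := hθ.exists_generatedAt hS
  refine ⟨r, X, hX, fun k f hf => ?_⟩
  have hstep : ∀ (j : ℕ) (f : {f // (θ f).1 (k + j + 1) = 0}),
      ∃ g : Fin r → CompletedPathAlgebra V, (∀ i, (θ (g i)).1 (k + j) = 0) ∧
        (θ (f.1 - ∑ i, g i * X i)).1 (k + (j + 1) + 1) = 0 := by
    rintro j ⟨f, hf⟩
    obtain ⟨g, hg, h⟩ := hgen (k + j) f hf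
    exact ⟨g, hg, by rwa [map_sub]⟩
  choose G hG hG' using hstep
  let F : ∀ j, {f // (θ f).1 (k + j + 1) = 0} :=
    fun j => Nat.rec ⟨f, hf⟩ (fun j f => ⟨_, hG' j f⟩) j
  have hF : ∀ j, (F (j + 1)).1 = (F j).1 - ∑ i, G j (F j) i * X i := fun j => rfl
  have hlim := fun i => hθ.exists_sum_sub (fun j => G j (F j) i) fun j =>
    coe_eq_zero_of_le (Nat.le_add_left j k) (hG j (F j) i)
  choose g hg using hlim
  refine ⟨g, fun i => ?_, hθ.mem_of_forall_coe_eq_zero fun j => ?_⟩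
  · have h1 := hg i k
    rw [map_sub, coe_sub, sub_eq_zero] at h1
    rw [h1]
    exact coe_sum_eq_zero _ _ fun j _ => coe_eq_zero_of_le (Nat.le_add_right k j) (hG j (F j) i)
  · have h1 : ∀ j, (F j).1 = f - ∑ i, (∑ l ∈ Finset.range j, G l (F l) i) * X i := by
      intro j
      induction j with
      | zero => simp [F]
      | succ j ih =>
        rw [hF, ih]
        simp only [Finset.sum_range_succ, add_mul, Finset.sum_add_distrib]
        abel
    have h2 : f - ∑ i, g i * X i =
        (F j).1 - ∑ i, (g i - ∑ l ∈ Finset.range j, G l (F l) i) * X i := by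
      rw [h1 j]
      simp only [sub_mul, Finset.sum_sub_distrib]
      abel
    rw [h2, map_sub, coe_sub, coe_eq_zero_of_le (by omega) (F j).2, zero_sub, neg_eq_zero]
    refine coe_sum_eq_zero _ _ fun i _ => ?_
    rw [map_mul, coe_mul, hg i j, zero_mul]

/-- Modulo I, hence modulo degree two, each arrow is a combination Σ g_i X_i. As the X_i have no
constant term, the arrow must appear in the linear part of some X_i, and these linear parts involve
finitely many arrows. -/
theorem finite_arrows [Algebra.FiniteType ℂ A] (hθ : IsCornerPresentation A N S I θ)
    (hS : IsListOfFactors A N S) (hI : ∀ f ∈ I, DegreeGE 2 f) : Finite (Σ v w : V, (v ⟶ w)) := by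
  classical
  obtain ⟨r, X, hX, hgen⟩ := hθ.exists_generators hS
  let i : (Σ v w : V, (v ⟶ w)) → Σ a b : V, Quiver.Path a b := fun e => ⟨e.1, e.2.1, e.2.2.toPath⟩
  have hi : Function.Injective i := by
    rintro ⟨v, w, e⟩ ⟨v', w', e'⟩ h
    obtain rfl : v = v' := congrArg Sigma.fst h
    have h1 := eq_of_heq (Sigma.mk.inj h).2
    obtain rfl : w = w' := congrArg Sigma.fst h1
    have h2 : e.toPath = e'.toPath := eq_of_heq (Sigma.mk.inj h1).2
    obtain rfl := eq_of_heq (Quiver.Path.cons.inj h2).2.2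
    rfl
  have hfin := (Set.finite_iUnion fun j => (X j).2 1).preimage (f := i) hi.injOn
  refine Set.finite_univ_iff.1 (hfin.subset ?_)
  rintro ⟨v, w, e⟩ -
  simp only [Set.mem_preimage, Set.mem_iUnion]
  obtain ⟨g, -, hg⟩ := hgen 0 (arrow e) ((hθ.coe_one_eq_zero_iff hS).2 (degreeGE_arrow e))
  have h1 := hI _ hg v w e.toPath (by simp [Quiver.Hom.toPath])
  rw [coeff_sub, coeff_sum, coeff_arrow_toPath, if_pos rfl, sub_eq_zero] at h1
  obtain ⟨j, -, hj⟩ := Finset.exists_ne_zero_of_sum_ne_zero (h1 ▸ one_ne_zero)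
  refine ⟨j, rfl, fun h0 => hj ?_⟩
  have hXj := DegreeGE.one_iff.1 ((hθ.coe_one_eq_zero_iff hS).1 (hX j)) v
  rw [coeff_mul_toPath, hXj, mul_zero, add_zero]
  exact mul_eq_zero_of_right _ h0

/-- By induction the coefficients g_i in f ≡ Σ g_i X_i have degree at least k modulo I, and each X_i
contributes one more degree. Together with `coe_eq_zero_of_degreeGE` this matches the adic and
degree filtrations modulo I. -/
theorem exists_degreeGE_sub [Algebra.FiniteType ℂ A] [I.IsTwoSided] (hθ : IsCornerPresentation A N S I θ)
    (hS : IsListOfFactors A N S) {k : ℕ} {f : CompletedPathAlgebra V} (hf : (θ f).1 k = 0) :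
    ∃ h ∈ I, DegreeGE k (f - h) := by
  obtain ⟨r, X, hX, hgen⟩ := hθ.exists_generators hS
  induction k generalizing f with
  | zero => exact ⟨0, zero_mem _, DegreeGE.of_zero _⟩
  | succ k ih =>
    obtain ⟨g, hg, hfg⟩ := hgen k f hf
    choose h hhI hh using fun i => ih (hg i)
    refine ⟨f - ∑ i, g i * X i + ∑ i, h i * X i, add_mem hfg (sum_mem fun i _ =>
      Ideal.mul_mem_right _ _ (hhI i)), ?_⟩
    have h1 : f - (f - ∑ i, g i * X i + ∑ i, h i * X i) = ∑ i, (g i - h i) * X i := by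
      simp only [sub_mul, Finset.sum_sub_distrib]
      abel
    rw [h1]
    exact DegreeGE.sum _ _ fun i _ => (hh i).mul ((hθ.coe_one_eq_zero_iff hS).1 (hX i))

/-- An element of degree k + 1 is a finite sum of arrows times elements of degree k, and arrows have
order one. An infinite sum of such products could not be treated term by term, hence the appeal to
`finite_arrows`. -/
theorem coe_eq_zero_of_degreeGE [Algebra.FiniteType ℂ A] (hθ : IsCornerPresentation A N S I θ)
    (hS : IsListOfFactors A N S) (hI : ∀ f ∈ I, DegreeGE 2 f) {k : ℕ} {f : CompletedPathAlgebra V}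
    (hf : DegreeGE k f) : (θ f).1 k = 0 := by
  have := hθ.finite_arrows hS hI
  have := Fintype.ofFinite V
  have := Fintype.ofFinite (Σ v w : V, (v ⟶ w))
  induction k generalizing f with
  | zero => exact coe_zero_index _
  | succ k ih =>
    have h0 : ∀ v : V, f.1 v v Quiver.Path.nil = 0 := fun v => hf _ _ _ (Nat.succ_pos k)
    rw [eq_sum_arrow_mul f]
    simp only [h0, zero_smul, Finset.sum_const_zero, zero_add]
    refine coe_sum_eq_zero _ _ fun e _ => ?_
    rw [add_comm]
    exact coe_mul_eq_zero_of ((hθ.coe_one_eq_zero_iff hS).2 (degreeGE_arrow _))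
      (ih (degreeGE_cancelArrow _ hf))

end

end IsCornerPresentation

/-! ### Closed ideals -/

section

variable {V : Type*} [Finite V] [Quiver V]

theorem isClosedIdeal_closedIdealSpan (R : Set (CompletedPathAlgebra V)) :
    IsClosedIdeal (closedIdealSpan R) := by
  intro f hf
  rw [closedIdealSpan, Submodule.mem_sInf]
  intro I hI
  refine hI.2.1 f fun n => ?_
  obtain ⟨g, hg, h⟩ := hf n
  exact ⟨g, (Submodule.mem_sInf.1 hg) I hI, h⟩

theorem subset_closedIdealSpan (R : Set (CompletedPathAlgebra V)) :
    R ⊆ closedIdealSpan R := fun _ hx =>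
  Submodule.mem_sInf.2 fun _ hI => hI.2.2 hx

theorem closedIdealSpan_le {R : Set (CompletedPathAlgebra V)} (J : Ideal (CompletedPathAlgebra V))
    [J.IsTwoSided] (hJ : IsClosedIdeal J) (hR : R ⊆ J) : closedIdealSpan R ≤ J :=
  sInf_le ⟨inferInstance, hJ, hR⟩

/-- The series of degree at least k themselves form a closed two-sided ideal. -/
theorem degreeGE_of_mem_closedIdealSpan {R : Set (CompletedPathAlgebra V)} {k : ℕ}
    (hR : ∀ f ∈ R, DegreeGE k f) {f : CompletedPathAlgebra V} (hf : f ∈ closedIdealSpan R) :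
    DegreeGE k f := by
  let J : Ideal (CompletedPathAlgebra V) :=
    { carrier := {f | DegreeGE k f}
      add_mem' := DegreeGE.add
      zero_mem' := DegreeGE.zero k
      smul_mem' := fun c _ h => DegreeGE.mul_left c h }
  have : J.IsTwoSided := ⟨fun b h => DegreeGE.mul_right b h⟩
  refine closedIdealSpan_le J (fun f hf => ?_) hR hf
  obtain ⟨g, hg, h⟩ := hf k
  have hg' : DegreeGE k g := hg
  have := h.add hg'
  rwa [sub_add_cancel] at this

/-- The projection does not lower degrees, so the preimage of a closed ideal is closed. -/
theorem KeepVertices.proj_mem_closedIdealSpan (P : V → Prop) {R : Set (CompletedPathAlgebra V)}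
    {f : CompletedPathAlgebra V} (hf : f ∈ closedIdealSpan R) :
    KeepVertices.proj P f ∈ closedIdealSpan (KeepVertices.proj P '' R) := by
  have : (Ideal.comap (KeepVertices.proj P) (closedIdealSpan (KeepVertices.proj P '' R))).IsTwoSided :=
    ⟨fun b ha => by
      rw [Ideal.mem_comap] at ha ⊢
      rw [map_mul]
      exact Ideal.mul_mem_right _ _ ha⟩
  refine closedIdealSpan_le
    (Ideal.comap (KeepVertices.proj P) (closedIdealSpan (KeepVertices.proj P '' R))) (fun f hf => ?_) ?_ hf
  · refine isClosedIdeal_closedIdealSpan _ _ fun n => ?_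
    obtain ⟨g, hg, h⟩ := hf n
    refine ⟨KeepVertices.proj P g, hg, ?_⟩
    rw [← map_sub]
    exact KeepVertices.degreeGE_proj P h
  · intro x hx
    exact subset_closedIdealSpan _ ⟨x, hx, rfl⟩

end

/-! ### Passage to a submodule -/

/-- A simple submodule of M is one of N, hence isomorphic to some `S v`; that isomorphism also shows
that v is kept. -/
theorem IsListOfFactors.keepVertices {A : Type*} [Ring A] {N : Type*} [AddCommGroup N] [Module A N]
    {V : Type*} {S : V → Type*} [∀ v, AddCommGroup (S v)] [∀ v, Module A (S v)]
    (hS : IsListOfFactors A N S) (M : Submodule A N) :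
    IsListOfFactors A M (fun v : KeepVertices (fun v => OccursIn A (S v) M) => S v.val) where
  simple v := hS.simple v.val
  occurs v := v.property
  distinct v w h := by
    obtain ⟨v, _⟩ := v
    obtain ⟨w, _⟩ := w
    obtain rfl : v = w := hS.distinct _ _ h
    rfl
  complete T hT := by
    let f : T →ₗ[A] N := M.subtype.comp T.subtype
    have hf : Function.Injective f := Subtype.val_injective.comp Subtype.val_injective
    let E := LinearEquiv.ofInjective f hf
    obtain ⟨v, ⟨F⟩⟩ := hS.complete (LinearMap.range f) (IsSimpleModule.congr E.symm)
    let G := E.trans F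
    exact ⟨⟨v, T.subtype.comp G.symm.toLinearMap, Subtype.val_injective.comp G.symm.injective⟩, ⟨G⟩⟩

namespace IsCornerPresentation

open adicCompletionAt CompletedPathAlgebra KeepVertices

variable {A : Type*} [Ring A] [Algebra ℂ A] {N : Type*} [AddCommGroup N] [Module A N]
  {V : Type*} [Finite V] [Quiver V] {S : V → Type*} [∀ v, AddCommGroup (S v)]
  [∀ v, Module ℂ (S v)] [∀ v, Module A (S v)] [∀ v, IsScalarTower ℂ A (S v)]
  {I : Ideal (CompletedPathAlgebra V)}
  {θ : CompletedPathAlgebra V →ₙₐ[ℂ] adicCompletionAt (Module.annihilator A N)}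

theorem annihilator_le (M : Submodule A N) : Module.annihilator A N ≤ Module.annihilator A M :=
  LinearMap.annihilator_le_of_injective M.subtype Subtype.val_injective

/-- The composition of `θ` with the map of completions for a submodule. -/
def mapSubmodule (θ : CompletedPathAlgebra V →ₙₐ[ℂ] adicCompletionAt (Module.annihilator A N))
    (M : Submodule A N) : CompletedPathAlgebra V →ₙₐ[ℂ] adicCompletionAt (Module.annihilator A M) :=
  ((adicCompletionAt.map (annihilator_le M) :
    adicCompletionAt (Module.annihilator A N) →ₙₐ[ℂ] adicCompletionAt (Module.annihilator A M))).comp θ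

theorem mapSubmodule_apply (M : Submodule A N) (f : CompletedPathAlgebra V) :
    mapSubmodule θ M f = adicCompletionAt.map (annihilator_le M) (θ f) := rfl

theorem coe_mapSubmodule_eq_zero (M : Submodule A N) {f : CompletedPathAlgebra V} {k : ℕ}
    (hf : (θ f).1 k = 0) : (mapSubmodule θ M f).1 k = 0 := by
  rw [mapSubmodule_apply, coe_map, hf, map_zero]

section

variable [Module ℂ N] [IsScalarTower ℂ A N] [FiniteDimensional ℂ N] [IsSemisimpleModule A N]

theorem rep_vertexIdempotent_mem (hθ : IsCornerPresentation A N S I θ) (hS : IsListOfFactors A N S)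
    (M : Submodule A N) {v : V} (hv : ¬ OccursIn A (S v) M) {a : A}
    (ha : Ideal.Quotient.mk (Module.annihilator A N ^ 1) a = (θ (vertexIdempotent v)).1 1) :
    a ∈ Module.annihilator A M := by
  have h1 : Ideal.Quotient.mk (Module.annihilator A M ^ 1) a = 0 := by
    refine (hS.keepVertices M).eq_zero_of_action fun w => ?_
    have h2 := hθ.vertexAction_of_ne hS (v := v) (w := w.val) (fun h => hv (h ▸ w.property))
    rw [vertexAction_apply, ← ha, IsListOfFactors.action_mk] at h2
    rw [IsListOfFactors.action_mk]
    exact h2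
  rwa [Ideal.Quotient.eq_zero_iff_mem, Submodule.pow_one] at h1

/-- For a deleted vertex, a_v lies in 𝔪 and is idempotent modulo 𝔫, so a_v q ≡ a_v(a_v q) lies in 𝔪²
modulo 𝔫. -/
theorem annihilator_le_sup_sq (hθ : IsCornerPresentation A N S I θ) (hS : IsListOfFactors A N S)
    (M : Submodule A N) :
    Module.annihilator A M ≤ Module.annihilator A N ⊔ Module.annihilator A M ^ 2 := by
  choose a ha using fun v => Ideal.Quotient.mk_surjective ((θ (vertexIdempotent v)).1 1)
  refine (hθ.annihilator_le_vertexIdeal_sup hS (M := M) (fun v => ¬ OccursIn A (S v) M)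
    (fun v h => not_not.1 h) a ha).trans (sup_le ?_ le_sup_left)
  refine Ideal.span_le.2 ?_
  rintro _ ⟨v, q, hv, rfl⟩
  have ham := hθ.rep_vertexIdempotent_mem hS M hv (ha v)
  have h1 : a v - a v * a v ∈ Module.annihilator A N := by
    rw [← Submodule.pow_one (Module.annihilator A N), ← Ideal.Quotient.eq, map_mul, ha, ← coe_mul,
      ← map_mul, vertexIdempotent_mul_self]
  have h2 : a v * q = (a v - a v * a v) * q + a v * (a v * q) := by
    rw [sub_mul, mul_assoc, sub_add_cancel]
  rw [h2]
  refine Submodule.add_mem_sup (Ideal.mul_mem_right _ _ h1) ?_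
  rw [Submodule.pow_succ, Submodule.pow_one]
  exact Ideal.mul_mem_mul ham (Ideal.mul_mem_right _ _ ham)

/-- The image is an idempotent that vanishes modulo 𝔪. Multiplying it by itself raises its order
step by step, so it vanishes at every level. -/
theorem mapSubmodule_vertexIdempotent (hθ : IsCornerPresentation A N S I θ) (hS : IsListOfFactors A N S)
    (M : Submodule A N) {v : V} (hv : ¬ OccursIn A (S v) M) :
    mapSubmodule θ M (vertexIdempotent v) = 0 := by
  have h1 : (mapSubmodule θ M (vertexIdempotent v)).1 1 = 0 := by
    obtain ⟨a, ha⟩ := Ideal.Quotient.mk_surjective ((θ (vertexIdempotent v)).1 1)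
    rw [mapSubmodule_apply, coe_map_of_eq _ ha.symm, Ideal.Quotient.eq_zero_iff_mem, Submodule.pow_one]
    exact hθ.rep_vertexIdempotent_mem hS M hv ha
  refine ext_coe fun k => ?_
  induction k with
  | zero => rw [coe_zero_index, coe_zero]
  | succ k ih =>
    rw [← vertexIdempotent_mul_self, map_mul]
    exact coe_mul_eq_zero ih h1

/-- Induction on the level, peeling off the last arrow e. If e ends at a deleted vertex w, then e =
ε_w e is killed. Otherwise e gains one order and the cofactor is again in the kernel of the
projection. -/
theorem mapSubmodule_eq_zero_of_proj [Algebra.FiniteType ℂ A] (hθ : IsCornerPresentation A N S I θ)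
    (hS : IsListOfFactors A N S) (hI : ∀ f ∈ I, DegreeGE 2 f) (M : Submodule A N)
    {f : CompletedPathAlgebra V} (hf : proj (fun v => OccursIn A (S v) M) f = 0) :
    mapSubmodule θ M f = 0 := by
  have := hθ.finite_arrows hS hI
  have := Fintype.ofFinite V
  have := Fintype.ofFinite (Σ v w : V, (v ⟶ w))
  refine ext_coe fun k => ?_
  induction k generalizing f with
  | zero => rw [coe_zero_index, coe_zero]
  | succ k ih =>
    rw [eq_sum_arrow_mul f, map_add, coe_add, map_sum, map_sum, coe_sum, coe_sum, coe_zero,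
      Finset.sum_eq_zero, Finset.sum_eq_zero, add_zero]
    · rintro ⟨v, w, e⟩ -
      by_cases hw : OccursIn A (S w) M
      · rw [map_mul, add_comm k 1]
        exact coe_mul_eq_zero (coe_mapSubmodule_eq_zero M
          ((hθ.coe_one_eq_zero_iff hS).2 (degreeGE_arrow e))) (ih (proj_cancelArrow (fun v => OccursIn A (S v) M) hw e hf))
      · rw [← vertexIdempotent_mul_arrow, map_mul, map_mul, hθ.mapSubmodule_vertexIdempotent hS M hw,
          zero_mul, zero_mul, coe_zero]
    · rintro v -
      by_cases hv : OccursIn A (S v) M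
      · have h0 : (proj (fun v => OccursIn A (S v) M) f).1 ⟨v, hv⟩ ⟨v, hv⟩ Quiver.Path.nil = 0 := by
          rw [hf, coeff_zero]
        have h1 : f.1 v v Quiver.Path.nil = 0 := h0
        rw [h1, zero_smul, map_zero, coe_zero]
      · rw [map_smul, hθ.mapSubmodule_vertexIdempotent hS M hv, smul_zero, coe_zero]

theorem mapSubmodule_eq_of_proj [Algebra.FiniteType ℂ A] (hθ : IsCornerPresentation A N S I θ)
    (hS : IsListOfFactors A N S) (hI : ∀ f ∈ I, DegreeGE 2 f) (M : Submodule A N)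
    {f g : CompletedPathAlgebra V}
    (hf : proj (fun v => OccursIn A (S v) M) f = proj (fun v => OccursIn A (S v) M) g) :
    mapSubmodule θ M f = mapSubmodule θ M g := by
  rw [← sub_eq_zero, ← map_sub]
  exact hθ.mapSubmodule_eq_zero_of_proj hS hI M (by rw [map_sub, hf, sub_self])

/-- The homomorphism induced on the completed path algebra of the remaining quiver. -/
def restrict [Algebra.FiniteType ℂ A] (hθ : IsCornerPresentation A N S I θ)
    (hS : IsListOfFactors A N S) (hI : ∀ f ∈ I, DegreeGE 2 f) (M : Submodule A N) :
    CompletedPathAlgebra (KeepVertices fun v => OccursIn A (S v) M) →ₙₐ[ℂ]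
      adicCompletionAt (Module.annihilator A M) where
  toFun g := mapSubmodule θ M (extend _ g)
  map_smul' c g := by
    rw [MonoidHom.id_apply, ← map_smul]
    -- Of `extend` only the property of being a section of `proj` is used; the algebraic identities
    -- are checked after projecting.
    refine hθ.mapSubmodule_eq_of_proj hS hI M ?_
    rw [map_smul, proj_extend, proj_extend]
  map_zero' := hθ.mapSubmodule_eq_zero_of_proj hS hI M (proj_extend _ _)
  map_add' g h := by
    rw [← map_add]
    refine hθ.mapSubmodule_eq_of_proj hS hI M ?_
    rw [map_add, proj_extend, proj_extend, proj_extend]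
  map_mul' g h := by
    rw [← map_mul]
    refine hθ.mapSubmodule_eq_of_proj hS hI M ?_
    rw [map_mul, proj_extend, proj_extend, proj_extend]

theorem restrict_apply [Algebra.FiniteType ℂ A] (hθ : IsCornerPresentation A N S I θ)
    (hS : IsListOfFactors A N S) (hI : ∀ f ∈ I, DegreeGE 2 f) (M : Submodule A N)
    (g : CompletedPathAlgebra (KeepVertices fun v => OccursIn A (S v) M)) :
    hθ.restrict hS hI M g = mapSubmodule θ M (extend _ g) := rfl

theorem restrict_proj [Algebra.FiniteType ℂ A] (hθ : IsCornerPresentation A N S I θ)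
    (hS : IsListOfFactors A N S) (hI : ∀ f ∈ I, DegreeGE 2 f) (M : Submodule A N)
    (f : CompletedPathAlgebra V) :
    hθ.restrict hS hI M (proj _ f) = mapSubmodule θ M f :=
  hθ.mapSubmodule_eq_of_proj hS hI M (proj_extend _ _)

/-- Modulo the `j`-th step of the adic filtration, elements of `e Â e` that come from the ideal
generated by the deleted vertices lift to elements of the kernel of the standard projection. -/
theorem exists_proj_eq_zero (hθ : IsCornerPresentation A N S I θ) (P : V → Prop) {a : V → A} {j : ℕ}
    (ha : ∀ v, Ideal.Quotient.mk (Module.annihilator A N ^ j) (a v) = (θ (vertexIdempotent v)).1 j)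
    {b : A} (hb : b ∈ vertexIdeal a (fun v => ¬ P v) ⊔ Module.annihilator A N ^ j) :
    ∃ h, proj P h = 0 ∧ (θ 1 * of _ b * θ 1 - θ h).1 j = 0 := by
  obtain ⟨y, hy, ν, hν, rfl⟩ := Submodule.mem_sup.1 hb
  have of_add : ∀ x y : A, of (Module.annihilator A N) (x + y) = of _ x + of _ y := fun x y => rfl
  have of_mul : ∀ x y : A, of (Module.annihilator A N) (x * y) = of _ x * of _ y := fun x y => rfl
  have of_zero : ∀ x : A, x ∈ Module.annihilator A N ^ j →
      (of (Module.annihilator A N) x).1 j = 0 := fun x h => Ideal.Quotient.eq_zero_iff_mem.2 h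
  have key : ∀ c : A, ∃ h, proj P h = 0 ∧ (θ 1 * of _ (c * y) * θ 1 - θ h).1 j = 0 := by
    clear hb
    induction hy using Submodule.span_induction with
    | zero =>
      intro c
      refine ⟨0, map_zero _, ?_⟩
      rw [mul_zero, map_zero, sub_zero, coe_mul, coe_mul, of_zero 0 (zero_mem _), mul_zero, zero_mul]
    | add y y' _ _ h h' =>
      intro c
      obtain ⟨h, h0, h1⟩ := h c
      obtain ⟨h', h0', h1'⟩ := h' c
      refine ⟨h + h', by rw [map_add, h0, h0', add_zero], ?_⟩
      have : θ 1 * of _ (c * (y + y')) * θ 1 - θ (h + h') =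
          (θ 1 * of _ (c * y) * θ 1 - θ h) + (θ 1 * of _ (c * y') * θ 1 - θ h') := by
        rw [mul_add, of_add, mul_add, add_mul, map_add]
        abel
      rw [this, coe_add, h1, h1', add_zero]
    | smul p y _ h =>
      intro c
      rw [smul_eq_mul, ← mul_assoc]
      exact h _
    | mem y hy =>
      obtain ⟨v, q, hv, rfl⟩ := hy
      intro c
      obtain ⟨F, hF⟩ := hθ.exists_eq_mul_mul (of _ c)
      obtain ⟨G, hG⟩ := hθ.exists_eq_mul_mul (of _ q)
      refine ⟨F * vertexIdempotent v * G, ?_, ?_⟩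
      · rw [map_mul, map_mul, proj_vertexIdempotent_of_not P hv, mul_zero, zero_mul]
      · have h4 : θ 1 * θ (vertexIdempotent v) * θ 1 = θ (vertexIdempotent v) := one_mul_mul_one _
        have h3 : θ (F * vertexIdempotent v * G) =
            θ 1 * (of _ c * (θ (vertexIdempotent v) * of _ q)) * θ 1 := by
          -- The factors e on either side of ε_v come from F and G and are absorbed, since e ε_v e =
          -- ε_v.
          calc θ (F * vertexIdempotent v * G)
              = θ 1 * of _ c * ((θ 1 * θ (vertexIdempotent v) * θ 1) * of _ q) * θ 1 := by
                rw [map_mul, map_mul, hF, hG]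
                simp only [mul_assoc]
            _ = _ := by
                rw [h4]
                simp only [mul_assoc]
        rw [h3, ← sub_mul, ← mul_sub, of_mul, of_mul, ← mul_sub, ← sub_mul]
        simp only [coe_mul, coe_sub, coe_of, ha, sub_self, mul_zero, zero_mul]
  obtain ⟨h, h0, h1⟩ := key 1
  refine ⟨h, h0, ?_⟩
  rw [one_mul] at h1
  have : θ 1 * of _ (y + ν) * θ 1 - θ h = (θ 1 * of _ y * θ 1 - θ h) + θ 1 * of _ ν * θ 1 := by
    rw [of_add, mul_add, add_mul]
    abel
  rw [this, coe_add, h1, coe_mul, coe_mul, of_zero ν hν, mul_zero, zero_mul, add_zero]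

theorem restrict_eq_zero_iff [Algebra.FiniteType ℂ A] {R : Set (CompletedPathAlgebra V)}
    (hθ : IsCornerPresentation A N S (closedIdealSpan R) θ)
    (hS : IsListOfFactors A N S) (hI : ∀ f ∈ closedIdealSpan R, DegreeGE 2 f) (M : Submodule A N)
    (g : CompletedPathAlgebra (KeepVertices fun v => OccursIn A (S v) M)) :
    hθ.restrict hS hI M g = 0 ↔
      g ∈ closedIdealSpan (proj (fun v => OccursIn A (S v) M) '' R) := by
  constructor
  · intro hg
    refine isClosedIdeal_closedIdealSpan _ _ fun k => ?_
    set f := extend _ g with hf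
    -- One representative has to serve both modulo 𝔫, to describe 𝔪, and modulo the power at which
    -- θ(f) is approximated. Level k + 1 covers level 1 even for k = 0.
    choose a ha using fun v => exists_rep (θ (vertexIdempotent v)) (k + 1)
    obtain ⟨b, hb⟩ := exists_rep (θ f) (k + 1)
    have hbm : b ∈ Module.annihilator A M ^ (k + 1) := by
      rw [← Ideal.Quotient.eq_zero_iff_mem, ← coe_map_of_eq (annihilator_le M) (hb _ le_rfl)]
      rw [restrict_apply, mapSubmodule_apply] at hg
      rw [hg, coe_zero]
    have hle := hθ.annihilator_le_vertexIdeal_sup hS (M := M) (fun v => ¬ OccursIn A (S v) M)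
      (fun v h => not_not.1 h) a (fun v => (ha v 1 (Nat.le_add_left 1 k)).symm)
    obtain ⟨h, h0, h1⟩ := hθ.exists_proj_eq_zero (fun v => OccursIn A (S v) M)
      (fun v => (ha v _ le_rfl).symm) (Ideal.pow_le_sup_pow _ _ _ hle (k + 1) hbm)
    have h2 : (θ (f - h)).1 (k + 1) = 0 := by
      rw [coe_sub, coe_mul, coe_mul, coe_of, ← hb _ le_rfl, ← coe_mul, ← coe_mul, ← coe_sub,
        one_mul_mul_one, ← map_sub] at h1
      exact h1
    obtain ⟨h', hh', hdeg⟩ := hθ.exists_degreeGE_sub hS h2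
    refine ⟨proj _ h', proj_mem_closedIdealSpan _ hh', ?_⟩
    have h3 := degreeGE_proj (fun v => OccursIn A (S v) M) hdeg
    rw [map_sub, map_sub, h0, sub_zero, hf, proj_extend] at h3
    exact h3.mono (Nat.le_succ k)
  · intro hg
    -- The kernel of the restricted map is a two-sided ideal containing the π(r_i). It is closed
    -- because a series of degree k maps to something that vanishes at level k.
    let J : Ideal (CompletedPathAlgebra (KeepVertices fun v => OccursIn A (S v) M)) :=
      { carrier := {g | hθ.restrict hS hI M g = 0}
        add_mem' := fun {g h} (hg : hθ.restrict hS hI M g = 0) (hh : hθ.restrict hS hI M h = 0) => by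
          change hθ.restrict hS hI M (g + h) = 0
          rw [map_add, hg, hh, add_zero]
        zero_mem' := map_zero (hθ.restrict hS hI M)
        smul_mem' := fun c g (hg : hθ.restrict hS hI M g = 0) => by
          change hθ.restrict hS hI M (c * g) = 0
          rw [map_mul, hg, mul_zero] }
    have : J.IsTwoSided := ⟨fun {g} c (hg : hθ.restrict hS hI M g = 0) => by
      change hθ.restrict hS hI M (g * c) = 0
      rw [map_mul, hg, zero_mul]⟩
    refine closedIdealSpan_le J (fun g hg => ?_) ?_ hg
    · refine ext_coe fun k => ?_
      obtain ⟨h, (hh : hθ.restrict hS hI M h = 0), hgh⟩ := hg k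
      have h1 : (hθ.restrict hS hI M (g - h)).1 k = 0 :=
        coe_mapSubmodule_eq_zero M (hθ.coe_eq_zero_of_degreeGE hS hI (degreeGE_extend _ hgh))
      rwa [map_sub, hh, sub_zero] at h1
    · rintro _ ⟨x, hx, rfl⟩
      change hθ.restrict hS hI M (proj _ x) = 0
      rw [restrict_proj, mapSubmodule_apply, (hθ.eq_zero_iff x).2 (subset_closedIdealSpan R hx), map_zero]

/-- An element of the new corner is lifted to Â_𝔫, cut down by e there, and pulled back along θ. The
rank conditions pass to M since representatives of ε_v modulo 𝔪 and modulo 𝔫 act alike on the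
factors of M. -/
theorem isCornerPresentation_restrict [Algebra.FiniteType ℂ A] {R : Set (CompletedPathAlgebra V)}
    (hθ : IsCornerPresentation A N S (closedIdealSpan R) θ)
    (hS : IsListOfFactors A N S) (hI : ∀ f ∈ closedIdealSpan R, DegreeGE 2 f) (M : Submodule A N) :
    IsCornerPresentation A M (fun v : KeepVertices (fun v => OccursIn A (S v) M) => S v.val)
      (closedIdealSpan (proj (fun v => OccursIn A (S v) M) '' R)) (hθ.restrict hS hI M) := by
  have hrep : ∀ (v : KeepVertices (fun v => OccursIn A (S v) M)) (a : A),
      Ideal.Quotient.mk (Module.annihilator A M ^ 1) a =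
        (hθ.restrict hS hI M (vertexIdempotent v)).1 1 →
      ∃ b : A, Ideal.Quotient.mk (Module.annihilator A N ^ 1) b = (θ (vertexIdempotent v.val)).1 1 ∧
        ∀ w : KeepVertices (fun v => OccursIn A (S v) M),
          Algebra.lsmul ℂ ℂ (S w.val) a = Algebra.lsmul ℂ ℂ (S w.val) b := by
    intro v a ha
    obtain ⟨b, hb⟩ := Ideal.Quotient.mk_surjective ((θ (vertexIdempotent v.val)).1 1)
    refine ⟨b, hb, fun w => ?_⟩
    rw [← proj_vertexIdempotent, restrict_proj, mapSubmodule_apply, coe_map_of_eq _ hb.symm,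
      Ideal.Quotient.eq, Submodule.pow_one] at ha
    ext x
    have := (hS.keepVertices M).smul_eq_zero_of_mem_annihilator w ha x
    rwa [sub_smul, sub_eq_zero] at this
  refine ⟨hθ.restrict_eq_zero_iff hS hI M, fun y hy => ?_, fun v a ha => ?_, fun v w a hvw ha => ?_⟩
  · obtain ⟨x, rfl⟩ := map_surjective (annihilator_le M) (hθ.annihilator_le_sup_sq hS M) y
    obtain ⟨f, hf⟩ := hθ.exists_eq_mul_mul x
    refine ⟨proj _ f, ?_⟩
    rw [← map_one (proj _), restrict_proj, mapSubmodule_apply] at hy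
    rw [restrict_proj, mapSubmodule_apply, hf, map_mul, map_mul, hy]
  · obtain ⟨b, hb, h⟩ := hrep v a ha
    rw [h v]
    exact hθ.finrank_self v.val b hb
  · obtain ⟨b, hb, h⟩ := hrep v a ha
    rw [h w]
    refine hθ.finrank_of_ne v.val w.val b (fun h => hvw ?_) hb
    obtain ⟨v, _⟩ := v
    obtain ⟨w, _⟩ := w
    obtain rfl : v = w := h
    rfl

end

end IsCornerPresentation

theorem IsLocalModel.keepVertices {A : Type*} [Ring A] [Algebra ℂ A] [Algebra.FiniteType ℂ A]
    {N : Type*} [AddCommGroup N] [Module ℂ N] [Module A N] [IsScalarTower ℂ A N]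
    [FiniteDimensional ℂ N] [IsSemisimpleModule A N]
    {V : Type*} [Finite V] [Quiver V] {S : V → Type*} [∀ v, AddCommGroup (S v)]
    [∀ v, Module ℂ (S v)] [∀ v, Module A (S v)] [∀ v, IsScalarTower ℂ A (S v)]
    {R : Set (CompletedPathAlgebra V)} (hN : IsLocalModel A N S (closedIdealSpan R))
    (M : Submodule A N) :
    IsLocalModel A M (fun v : KeepVertices (fun v => OccursIn A (S v) M) => S v.val)
      (closedIdealSpan (KeepVertices.proj (fun v => OccursIn A (S v) M) '' R)) := by
  obtain ⟨θ, hθ⟩ := hN.exists_isCornerPresentation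
  refine (hθ.isCornerPresentation_restrict hN.factors hN.admissible M).isLocalModel
    (hN.factors.keepVertices M) (isClosedIdeal_closedIdealSpan _) fun f hf =>
      degreeGE_of_mem_closedIdealSpan ?_ hf
  rintro _ ⟨x, hx, rfl⟩
  exact KeepVertices.degreeGE_proj _ (hN.admissible x (subset_closedIdealSpan R hx))

/-! ### Uniqueness of the local quiver -/

namespace IsListOfFactors

variable {A : Type*} [Ring A] {M : Type*} [AddCommGroup M] [Module A M]
  {V₁ : Type*} {S₁ : V₁ → Type*} [∀ v, AddCommGroup (S₁ v)] [∀ v, Module A (S₁ v)]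
  {V₂ : Type*} {S₂ : V₂ → Type*} [∀ v, AddCommGroup (S₂ v)] [∀ v, Module A (S₂ v)]

theorem exists_linearEquiv (h₁ : IsListOfFactors A M S₁) (h₂ : IsListOfFactors A M S₂) (v : V₁) :
    ∃ w, Nonempty (S₁ v ≃ₗ[A] S₂ w) := by
  obtain ⟨f, hf⟩ := h₁.occurs v
  have := h₁.simple v
  let E := LinearEquiv.ofInjective f hf
  obtain ⟨w, ⟨F⟩⟩ := h₂.complete (LinearMap.range f) (IsSimpleModule.congr E.symm)
  exact ⟨w, ⟨E.trans F⟩⟩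

theorem exists_equiv (h₁ : IsListOfFactors A M S₁) (h₂ : IsListOfFactors A M S₂) :
    ∃ σ : V₁ ≃ V₂, ∀ v, Nonempty (S₁ v ≃ₗ[A] S₂ (σ v)) := by
  choose σ hσ using h₁.exists_linearEquiv h₂
  choose τ hτ using h₂.exists_linearEquiv h₁
  refine ⟨⟨σ, τ, fun v => ?_, fun v => ?_⟩, hσ⟩
  · exact (h₁.distinct _ _ ⟨(hσ v).some.trans (hτ (σ v)).some⟩).symm
  · exact (h₂.distinct _ _ ⟨(hτ v).some.trans (hσ (τ v)).some⟩).symm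

end IsListOfFactors

/-! ### Numbers of arrows as dimensions of ε_w(𝔪/𝔪²)ε_v -/

namespace IsCornerPresentation

open adicCompletionAt CompletedPathAlgebra

variable {A : Type*} [Ring A] [Algebra ℂ A] {M : Type*} [AddCommGroup M] [Module A M]

section

variable {V : Type*} [Finite V] [Quiver V]

/-- The subspace `ε_w (𝔪/𝔪²) ε_v` of `A/𝔪²`. -/
def arrowSpace (θ : CompletedPathAlgebra V →ₙₐ[ℂ] adicCompletionAt (Module.annihilator A M)) (v w : V) :
    Submodule ℂ (A ⧸ Module.annihilator A M ^ 2) :=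
  ((Module.annihilator A M).restrictScalars ℂ).map
    ((LinearMap.mulLeft ℂ ((θ (vertexIdempotent w)).1 2)).comp
      ((LinearMap.mulRight ℂ ((θ (vertexIdempotent v)).1 2)).comp
        (Ideal.Quotient.mkₐ ℂ (Module.annihilator A M ^ 2)).toLinearMap))

theorem mem_arrowSpace {θ : CompletedPathAlgebra V →ₙₐ[ℂ] adicCompletionAt (Module.annihilator A M)}
    {v w : V} {z : A ⧸ Module.annihilator A M ^ 2} :
    z ∈ arrowSpace θ v w ↔ ∃ x ∈ Module.annihilator A M,
      (θ (vertexIdempotent w) * (of _ x * θ (vertexIdempotent v))).1 2 = z :=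
  Iff.rfl

end

section

variable {V : Type*} [Finite V] [Quiver V] {S : V → Type*} [∀ v, AddCommGroup (S v)]
  [∀ v, Module ℂ (S v)] [∀ v, Module A (S v)] [∀ v, IsScalarTower ℂ A (S v)]
  {I : Ideal (CompletedPathAlgebra V)}
  {θ : CompletedPathAlgebra V →ₙₐ[ℂ] adicCompletionAt (Module.annihilator A M)}
  [Module ℂ M] [IsScalarTower ℂ A M] [FiniteDimensional ℂ M] [IsSemisimpleModule A M]

/-- The arrows from v to w give a basis. They are independent because a combination that vanishes
modulo 𝔪² lies in I plus degree two, hence has degree two. They span because an element of order one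
in the corner from v to w agrees with its linear part up to degree two. -/
theorem finrank_arrowSpace [Algebra.FiniteType ℂ A] [I.IsTwoSided] (hθ : IsCornerPresentation A M S I θ)
    (hS : IsListOfFactors A M S) (hI : ∀ f ∈ I, DegreeGE 2 f) (v w : V) [Fintype (v ⟶ w)] :
    Module.finrank ℂ (arrowSpace θ v w) = Fintype.card (v ⟶ w) := by
  classical
  let Λ : ((v ⟶ w) → ℂ) →ₗ[ℂ] A ⧸ Module.annihilator A M ^ 2 :=
    { toFun := fun c => (θ (∑ e, c e • arrow e)).1 2
      map_add' := fun c d => by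
        simp only [Pi.add_apply, add_smul, Finset.sum_add_distrib, map_add, coe_add]
      map_smul' := fun r c => by
        simp only [Pi.smul_apply, smul_assoc, ← Finset.smul_sum, map_smul, coe_smul, RingHom.id_apply] }
  have hΛ : ∀ c, Λ c = (θ (∑ e, c e • arrow e)).1 2 := fun c => rfl
  have hcoeff : ∀ (c : (v ⟶ w) → ℂ) (e : v ⟶ w), (∑ e, c e • arrow e).1 v w e.toPath = c e := by
    intro c e
    rw [coeff_sum]
    simp [coeff_arrow_toPath]
  have hinj : Function.Injective Λ := by
    refine (injective_iff_map_eq_zero _).2 fun c hc => funext fun e => ?_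
    obtain ⟨h, hhI, hh⟩ := hθ.exists_degreeGE_sub hS hc
    have h2 := hh.add (hI h hhI)
    rw [sub_add_cancel] at h2
    rw [← hcoeff c e]
    exact h2 v w _ (by simp [Quiver.Hom.toPath])
  have hrange : LinearMap.range Λ = arrowSpace θ v w := by
    refine le_antisymm ?_ fun z hz => ?_
    · rintro _ ⟨c, rfl⟩
      rw [mem_arrowSpace, hΛ]
      set f := ∑ e, c e • arrow e with hf
      have hf1 : (θ f).1 1 = 0 := (hθ.coe_one_eq_zero_iff hS).2
        (DegreeGE.sum _ _ fun e _ => (degreeGE_arrow e).smul _)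
      obtain ⟨x, hx⟩ := exists_rep (θ f) 2
      refine ⟨x, ?_, ?_⟩
      · rwa [hx 1 one_le_two, Ideal.Quotient.eq_zero_iff_mem, Submodule.pow_one] at hf1
      · rw [coe_mul, coe_mul, coe_of, ← hx 2 le_rfl, ← coe_mul, ← coe_mul, ← map_mul, ← map_mul]
        simp only [hf, Finset.mul_sum, Finset.sum_mul, mul_smul_comm, smul_mul_assoc,
          arrow_mul_vertexIdempotent, vertexIdempotent_mul_arrow]
    · obtain ⟨x, hx, rfl⟩ := mem_arrowSpace.1 hz
      obtain ⟨g, hg⟩ := hθ.exists_eq_mul_mul (of _ x)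
      set f := vertexIdempotent w * (g * vertexIdempotent v) with hf
      have hfx : θ f = θ (vertexIdempotent w) * (of _ x * θ (vertexIdempotent v)) := by
        calc θ f = θ (vertexIdempotent w) * θ 1 * of _ x * (θ 1 * θ (vertexIdempotent v)) := by
              rw [hf, map_mul, map_mul, hg]
              simp only [mul_assoc]
          _ = _ := by
              rw [← map_mul, ← map_mul, one_mul, mul_one]
              simp only [mul_assoc]
      have hx1 : (of (Module.annihilator A M) x).1 1 = 0 :=
        Ideal.Quotient.eq_zero_iff_mem.2 (by rwa [Submodule.pow_one])
      have hf1 : DegreeGE 1 f := (hθ.coe_one_eq_zero_iff hS).1 (by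
        rw [hfx, coe_mul, coe_mul, hx1, zero_mul, mul_zero])
      refine ⟨fun e => f.1 v w e.toPath, ?_⟩
      rw [hΛ, ← hfx, eq_comm, ← sub_eq_zero, ← coe_sub, ← map_sub]
      refine hθ.coe_eq_zero_of_degreeGE hS hI fun a b p hp => ?_
      rw [coeff_sub]
      obtain h0 | h1 : p.length = 0 ∨ p.length = 1 := by omega
      · have h2 : DegreeGE 1 (∑ e, f.1 v w e.toPath • arrow e : CompletedPathAlgebra V) :=
          DegreeGE.sum _ _ fun e _ => (degreeGE_arrow e).smul _
        rw [hf1 a b p (by omega), h2 a b p (by omega), sub_zero]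
      · by_cases hab : a = v ∧ b = w
        · obtain ⟨rfl, rfl⟩ := hab
          cases p with
          | nil => simp at h1
          | cons p e =>
            rw [Quiver.Path.length_cons, Nat.add_eq_right] at h1
            obtain rfl := Quiver.Path.eq_of_length_zero p h1
            obtain rfl := Quiver.Path.eq_nil_of_length_zero p h1
            exact sub_eq_zero.2 (hcoeff (fun e => f.1 _ _ e.toPath) e).symm
        · have h2 : f.1 a b p = 0 := by
            rw [hf, coeff_vertexIdempotent_mul, coeff_mul_vertexIdempotent]
            split_ifs with hb ha
            · exact absurd ⟨ha, hb⟩ hab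
            · rfl
            · rfl
          rw [h2, coeff_sum, Finset.sum_eq_zero, sub_zero]
          intro e _
          rw [coeff_smul, coeff_arrow, if_neg, mul_zero]
          intro h
          exact hab ⟨congrArg Sigma.fst h, congrArg (fun z : Σ a b : V, Quiver.Path a b => z.2.1) h⟩
  rw [← hrange, LinearMap.finrank_range_of_inj hinj, Module.finrank_fintype_fun_eq_card]

theorem exists_vertexAction_eq_self (hθ : IsCornerPresentation A M S I θ) (hS : IsListOfFactors A M S)
    (v : V) : ∃ t : S v, t ≠ 0 ∧ vertexAction hS θ v (vertexIdempotent v) t = t ∧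
      ∀ x, ∃ c : ℂ, vertexAction hS θ v (vertexIdempotent v) x = c • t := by
  obtain ⟨t, ht0, ht⟩ := finrank_eq_one_iff'.1 (hθ.finrank_range_vertexAction hS v)
  refine ⟨t.1, fun h => ht0 (Subtype.ext h), ?_, fun x => ?_⟩
  · obtain ⟨x, hx⟩ := t.2
    rw [← hx, ← Module.End.mul_apply, ← map_mul, vertexIdempotent_mul_self]
  · obtain ⟨c, hc⟩ := ht ⟨_, ⟨x, rfl⟩⟩
    exact ⟨c, (congrArg Subtype.val hc).symm⟩

end

variable [Module ℂ M] [IsScalarTower ℂ A M] [FiniteDimensional ℂ M] [IsSemisimpleModule A M]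
  {V₁ : Type*} [Finite V₁] [Quiver V₁] {S₁ : V₁ → Type*} [∀ v, AddCommGroup (S₁ v)]
  [∀ v, Module ℂ (S₁ v)] [∀ v, Module A (S₁ v)] [∀ v, IsScalarTower ℂ A (S₁ v)]
  {I₁ : Ideal (CompletedPathAlgebra V₁)} [I₁.IsTwoSided]
  {θ₁ : CompletedPathAlgebra V₁ →ₙₐ[ℂ] adicCompletionAt (Module.annihilator A M)}
  {V₂ : Type*} [Finite V₂] [Quiver V₂] {S₂ : V₂ → Type*} [∀ v, AddCommGroup (S₂ v)]
  [∀ v, Module ℂ (S₂ v)] [∀ v, Module A (S₂ v)] [∀ v, IsScalarTower ℂ A (S₂ v)]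
  {I₂ : Ideal (CompletedPathAlgebra V₂)} [I₂.IsTwoSided]
  {θ₂ : CompletedPathAlgebra V₂ →ₙₐ[ℂ] adicCompletionAt (Module.annihilator A M)}

/-- Minimal idempotents belonging to the same simple module are equivalent modulo the radical. -/
theorem exists_intertwiner (hθ₁ : IsCornerPresentation A M S₁ I₁ θ₁) (hS₁ : IsListOfFactors A M S₁)
    (hθ₂ : IsCornerPresentation A M S₂ I₂ θ₂) (hS₂ : IsListOfFactors A M S₂) {v₁ : V₁} {v₂ : V₂}
    (E : S₁ v₁ ≃ₗ[A] S₂ v₂) : ∃ a b : A,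
      (θ₁ (vertexIdempotent v₁) * of _ a * θ₂ (vertexIdempotent v₂) * of _ b * θ₁ (vertexIdempotent v₁) -
        θ₁ (vertexIdempotent v₁)).1 1 = 0 := by
  obtain ⟨t, ht0, ht, htx⟩ := hθ₁.exists_vertexAction_eq_self hS₁ v₁
  obtain ⟨s, hs0, hs, -⟩ := hθ₂.exists_vertexAction_eq_self hS₂ v₂
  have := hS₁.simple v₁
  -- In the simple module, a moves the line of the second idempotent to the line of the first, and b
  -- moves it back.
  obtain ⟨a, ha⟩ := IsSimpleModule.toSpanSingleton_surjective A
    (show E.symm s ≠ 0 from fun h => hs0 (E.symm.map_eq_zero_iff.1 h)) t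
  obtain ⟨b, hb⟩ := IsSimpleModule.toSpanSingleton_surjective A ht0 (E.symm s)
  rw [LinearMap.toSpanSingleton_apply] at ha hb
  refine ⟨a, b, hS₁.eq_zero_of_action fun w => ?_⟩
  rw [coe_sub, map_sub, sub_eq_zero]
  simp only [coe_mul, coe_of, map_mul]
  rw [← vertexAction_apply hS₁]
  by_cases hw : v₁ = w
  · subst hw
    ext x
    obtain ⟨c, hc⟩ := htx x
    have hq : hS₁.action v₁ ((θ₂ (vertexIdempotent v₂)).1 1) (E.symm s) = E.symm s := by
      obtain ⟨q, hq⟩ := Ideal.Quotient.mk_surjective ((θ₂ (vertexIdempotent v₂)).1 1)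
      rw [vertexAction_apply, ← hq] at hs
      rw [← hq]
      exact (E.symm.map_smul q s).symm.trans (congrArg E.symm hs)
    have hb' : hS₁.action v₁ (Ideal.Quotient.mk _ b) t = E.symm s := hb
    have ha' : hS₁.action v₁ (Ideal.Quotient.mk _ a) (E.symm s) = t := ha
    simp only [Module.End.mul_apply, hc, map_smul, hb', hq, ha', ht]
  · rw [hθ₁.vertexAction_of_ne hS₁ hw, mul_zero]

/-- The map z ↦ UzY between the two arrow spaces is built from intertwiners that are invertible
modulo the radical. On elements of order one the failure of invertibility has order two and is
invisible in A/𝔪², so the map is injective. -/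
theorem finrank_arrowSpace_le [Algebra.FiniteType ℂ A] (hθ₁ : IsCornerPresentation A M S₁ I₁ θ₁)
    (hS₁ : IsListOfFactors A M S₁) (hθ₂ : IsCornerPresentation A M S₂ I₂ θ₂)
    (hS₂ : IsListOfFactors A M S₂) {v₁ w₁ : V₁} {v₂ w₂ : V₂}
    (hv : Nonempty (S₁ v₁ ≃ₗ[A] S₂ v₂)) (hw : Nonempty (S₁ w₁ ≃ₗ[A] S₂ w₂)) :
    Module.finrank ℂ (arrowSpace θ₁ v₁ w₁) ≤ Module.finrank ℂ (arrowSpace θ₂ v₂ w₂) := by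
  have := finiteDimensional_quotient_sq (Module.annihilator A M)
  obtain ⟨E⟩ := hv
  obtain ⟨F⟩ := hw
  obtain ⟨a, b, hab⟩ := hθ₁.exists_intertwiner hS₁ hθ₂ hS₂ E
  obtain ⟨c, d, hcd⟩ := hθ₁.exists_intertwiner hS₁ hθ₂ hS₂ F
  set pv := θ₁ (vertexIdempotent v₁)
  set pw := θ₁ (vertexIdempotent w₁)
  set qv := θ₂ (vertexIdempotent v₂)
  set qw := θ₂ (vertexIdempotent w₂)
  have hpv : pv * pv = pv := by rw [← map_mul, vertexIdempotent_mul_self]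
  have hpw : pw * pw = pw := by rw [← map_mul, vertexIdempotent_mul_self]
  have hqv : qv * qv = qv := by rw [← map_mul, vertexIdempotent_mul_self]
  have hqw : qw * qw = qw := by rw [← map_mul, vertexIdempotent_mul_self]
  let U := qw * of _ d * pw
  let Y := pv * of _ a * qv
  let φ : A ⧸ Module.annihilator A M ^ 2 →ₗ[ℂ] A ⧸ Module.annihilator A M ^ 2 :=
    (LinearMap.mulLeft ℂ (U.1 2)).comp (LinearMap.mulRight ℂ (Y.1 2))
  have hφ : ∀ ζ : adicCompletionAt (Module.annihilator A M), φ (ζ.1 2) = (U * (ζ * Y)).1 2 := fun ζ => rfl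
  have hmem : ∀ z : arrowSpace θ₁ v₁ w₁, φ z.1 ∈ arrowSpace θ₂ v₂ w₂ := by
    rintro ⟨z, hz⟩
    obtain ⟨x, hx, rfl⟩ := mem_arrowSpace.1 hz
    obtain ⟨y, hy⟩ := exists_rep (of _ d * pw * (pw * (of _ x * pv)) * (pv * of _ a)) 2
    refine mem_arrowSpace.2 ⟨y, ?_, ?_⟩
    · have hx1 : (of (Module.annihilator A M) x).1 1 = 0 :=
        Ideal.Quotient.eq_zero_iff_mem.2 (by rwa [Submodule.pow_one])
      have h1 := hy 1 one_le_two
      simp only [coe_mul, hx1, mul_zero, zero_mul] at h1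
      rw [← Submodule.pow_one (Module.annihilator A M)]
      exact Ideal.Quotient.eq_zero_iff_mem.1 h1.symm
    · rw [hφ]
      change qw.1 2 * (Ideal.Quotient.mk _ y * qv.1 2) = _
      rw [← hy 2 le_rfl]
      simp only [U, Y, coe_mul, mul_assoc]
      rfl
  refine LinearMap.finrank_le_finrank_of_injective
    (f := (φ.comp (arrowSpace θ₁ v₁ w₁).subtype).codRestrict _ hmem) ?_
  refine (injective_iff_map_eq_zero _).2 ?_
  rintro ⟨z, hz⟩ h0
  have h0' : φ z = 0 := congrArg Subtype.val h0
  obtain ⟨x, hx, rfl⟩ := mem_arrowSpace.1 hz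
  refine Subtype.ext ?_
  change (pw * (of _ x * pv)).1 2 = 0
  set ζ := pw * (of _ x * pv) with hζ
  have hx1 : (of (Module.annihilator A M) x).1 1 = 0 :=
    Ideal.Quotient.eq_zero_iff_mem.2 (by rwa [Submodule.pow_one])
  have hζ1 : ζ.1 1 = 0 := by rw [hζ, coe_mul, coe_mul, hx1, zero_mul, mul_zero]
  rw [hφ] at h0'
  have h1 : (pw * of _ c * qw * U * (ζ * (Y * qv * of _ b * pv))).1 2 = 0 := by
    have : pw * of _ c * qw * U * (ζ * (Y * qv * of _ b * pv)) =
        pw * of _ c * qw * (U * (ζ * Y)) * (qv * of _ b * pv) := by simp only [mul_assoc]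
    rw [this, coe_mul, coe_mul _ (U * (ζ * Y)), h0', mul_zero, zero_mul]
  have hL : pw * of _ c * qw * U = pw * of _ c * qw * of _ d * pw := by
    calc pw * of _ c * qw * U = pw * of _ c * (qw * qw) * of _ d * pw := by simp only [U, mul_assoc]
      _ = _ := by rw [hqw]
  have hR : Y * qv * of _ b * pv = pv * of _ a * qv * of _ b * pv := by
    calc Y * qv * of _ b * pv = pv * of _ a * (qv * qv) * of _ b * pv := by simp only [Y, mul_assoc]
      _ = _ := by rw [hqv]
  rw [hL, hR] at h1
  set α := pw * of _ c * qw * of _ d * pw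
  set β := pv * of _ a * qv * of _ b * pv
  have hpζ : pw * (ζ * pv) = ζ := by
    calc pw * (ζ * pv) = (pw * pw) * (of _ x * (pv * pv)) := by simp only [hζ, mul_assoc]
      _ = ζ := by rw [hpw, hpv]
  -- α and β agree with the idempotents p_w and p_v modulo the radical and ζ has order one, so both
  -- correction terms have order two.
  have h2 : ζ = α * (ζ * β) - (α - pw) * (ζ * β) - pw * (ζ * (β - pv)) := by
    calc ζ = pw * (ζ * pv) := hpζ.symm
      _ = _ := by
        simp only [sub_mul, mul_sub]
        abel
  have h3 : ((α - pw) * (ζ * β)).1 2 = 0 :=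
    coe_mul_eq_zero (j := 1) (k := 1) hcd (by rw [coe_mul, hζ1, zero_mul])
  have h4 : (ζ * (β - pv)).1 2 = 0 := coe_mul_eq_zero (j := 1) (k := 1) hζ1 hab
  rw [h2, coe_sub, coe_sub, h1, h3, coe_mul, h4, mul_zero, sub_zero, sub_zero]

end IsCornerPresentation

/-- Two local models of an algebra at the same semisimple module have isomorphic quivers. -/
theorem IsLocalModel.exists_equiv_of_isLocalModel {A : Type*} [Ring A] [Algebra ℂ A]
    [Algebra.FiniteType ℂ A] {M : Type*} [AddCommGroup M] [Module ℂ M] [Module A M]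
    [IsScalarTower ℂ A M] [FiniteDimensional ℂ M] [IsSemisimpleModule A M]
    {V₁ : Type*} [Finite V₁] [Quiver V₁] {S₁ : V₁ → Type*} [∀ v, AddCommGroup (S₁ v)]
    [∀ v, Module ℂ (S₁ v)] [∀ v, Module A (S₁ v)] [∀ v, IsScalarTower ℂ A (S₁ v)]
    {I₁ : Ideal (CompletedPathAlgebra V₁)} [I₁.IsTwoSided]
    {V₂ : Type*} [Finite V₂] [Quiver V₂] {S₂ : V₂ → Type*} [∀ v, AddCommGroup (S₂ v)]
    [∀ v, Module ℂ (S₂ v)] [∀ v, Module A (S₂ v)] [∀ v, IsScalarTower ℂ A (S₂ v)]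
    {I₂ : Ideal (CompletedPathAlgebra V₂)} [I₂.IsTwoSided]
    (h₁ : IsLocalModel A M S₁ I₁) (h₂ : IsLocalModel A M S₂ I₂) :
    ∃ σ : V₁ ≃ V₂, (∀ v, Nonempty (S₁ v ≃ₗ[A] S₂ (σ v))) ∧
      ∀ v w, Nonempty ((v ⟶ w) ≃ (σ v ⟶ σ w)) := by
  obtain ⟨θ₁, hθ₁⟩ := h₁.exists_isCornerPresentation
  obtain ⟨θ₂, hθ₂⟩ := h₂.exists_isCornerPresentation
  obtain ⟨σ, hσ⟩ := h₁.factors.exists_equiv h₂.factors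
  refine ⟨σ, hσ, fun v w => ?_⟩
  have hf₁ := hθ₁.finite_arrows h₁.factors h₁.admissible
  have hf₂ := hθ₂.finite_arrows h₂.factors h₂.admissible
  have hfin₁ : Finite (v ⟶ w) := Finite.of_injective
    (fun e => (⟨v, w, e⟩ : Σ v w : V₁, (v ⟶ w))) fun e e' h => by simpa using h
  have hfin₂ : Finite (σ v ⟶ σ w) := Finite.of_injective
    (fun e => (⟨σ v, σ w, e⟩ : Σ v w : V₂, (v ⟶ w))) fun e e' h => by simpa using h
  have := Fintype.ofFinite (v ⟶ w)
  have := Fintype.ofFinite (σ v ⟶ σ w)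
  rw [← Fintype.card_eq, ← hθ₁.finrank_arrowSpace h₁.factors h₁.admissible,
    ← hθ₂.finrank_arrowSpace h₂.factors h₂.admissible]
  exact le_antisymm
    (hθ₁.finrank_arrowSpace_le h₁.factors hθ₂ h₂.factors (hσ v) (hσ w))
    (hθ₂.finrank_arrowSpace_le h₂.factors hθ₁ h₁.factors ((hσ v).map LinearEquiv.symm)
      ((hσ w).map LinearEquiv.symm))

end

theorem mainTheorem4 {A : Type*} [Ring A] [Algebra ℂ A] [Algebra.FiniteType ℂ A]
    {N : Type*} [AddCommGroup N] [Module ℂ N] [Module A N] [IsScalarTower ℂ A N]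
    [FiniteDimensional ℂ N] [IsSemisimpleModule A N]
    {V : Type*} [Finite V] [Quiver V] (S : V → Type*) [∀ v, AddCommGroup (S v)]
    [∀ v, Module ℂ (S v)] [∀ v, Module A (S v)] [∀ v, IsScalarTower ℂ A (S v)]
    {ι : Type*} (r : ι → CompletedPathAlgebra V)
    (hN : IsLocalModel A N S (closedIdealSpan (Set.range r)))
    (M : Submodule A N) :
    -- `L_M A` is `ℂQ̂'/(π(r i))`, where `Q'` is `Q` without the factors that do not occur in `M`
    IsLocalModel A M (fun v : KeepVertices (fun v => OccursIn A (S v) M) => S v.val)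
      (closedIdealSpan
        (Set.range fun i => KeepVertices.proj (fun v => OccursIn A (S v) M) (r i))) ∧
    -- the local quiver `Q_M`, whatever model is used to compute it, is this quiver `Q'`
    ∀ (V' : Type*) [Finite V'] [Quiver V'] (S' : V' → Type*) [∀ v, AddCommGroup (S' v)]
      [∀ v, Module ℂ (S' v)] [∀ v, Module A (S' v)] [∀ v, IsScalarTower ℂ A (S' v)],
      IsLocalQuiver A M S' →
        ∃ σ : V' ≃ KeepVertices (fun v => OccursIn A (S v) M),
          (∀ v, Nonempty (S' v ≃ₗ[A] S (σ v).val)) ∧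
          ∀ v w : V', Nonempty ((v ⟶ w) ≃ (σ v ⟶ σ w)) := by
  have hM : FiniteDimensional ℂ M :=
    Module.Finite.of_injective (M.subtype.restrictScalars ℂ) Subtype.val_injective
  have h := hN.keepVertices M
  rw [← Set.range_comp] at h
  refine ⟨h, ?_⟩
  intro V' _ _ S' _ _ _ _ ⟨I', _, h'⟩
  exact h'.exists_equiv_of_isLocalModel h
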